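/- There are universal constants $c_1,c_2>0$ such that for every dimension $d\ge 2$ there is a bias $b=(b_1,b_2)\in\mathbb{R}^2$ (depending only on $d$) with the following property. Let $$f_b(x_1,x_2;y)=\operatorname*{argmin}_{x_i\in\{x_1,x_2\}}\bigl[\|x_i-y\|_2^2+b_i\bigr]\qquad(x_1,x_2,y\in\mathbb{R}^d)$$ be the biased nearest neighbour function (ties broken arbitrarily). For all $r,H\in\mathbb{N}$ and all rank-$r$ heads $g_1,\dots,g_H$ of the form $$g_h(x_1,x_2,y)=V_hX\,\phi_h(K_hX,y),\qquad X=[x_1\ x_2]\in\mathbb{R}^{d\times 2},$$ where $V_h\in\mathbb{R}^{d\times d}$, $K_h$ is a real matrix with $d$ columns and rank at most $r$, and $\phi_h$ is an arbitrary measurable function with values in the simplex $\{p\in\mathbb{R}^2: p_1,p_2\ge 0,\ p_1+p_2=1\}$: if $$H\cdot\max_{h}\|V_h\|\le\frac{\exp(c_1(d-r))}{c_2d^2},$$ where $\|\cdot\|$ is the operator (spectral) norm, then $$\mathbb{E}\left[\Bigl\|f_b(x_1,x_2;y)-\sum_{h=1}^H g_h(x_1,x_2,y)\Bigr\|_2^2\right]>\frac1{20}.$$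 Here $(x_1,x_2)$ is uniformly distributed over the pairs of orthogonal vectors of Euclidean norm $d^2$ in $\mathbb{R}^d$, and $y\sim\mathcal{N}(0,I_d)$ is independent of $(x_1,x_2)$. -/

import Mathlib

open MeasureTheory ProbabilityTheory
open scoped Matrix

noncomputable section

/-- The orthogonal group `O(d)` of real orthogonal `d × d` matrices is compact. -/
instance orthogonalGroup_compactSpace (d : ℕ) :
    CompactSpace (Matrix.orthogonalGroup (Fin d) ℝ) := by
  have hclosed : IsClosed (Matrix.orthogonalGroup (Fin d) ℝ : Set (Matrix (Fin d) (Fin d) ℝ)) :=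
    isClosed_unitary
  have hbox : IsCompact
      (Set.pi Set.univ fun _ => Set.pi Set.univ fun _ => Set.Icc (-1) 1 :
        Set (Fin d → Fin d → ℝ)) :=
    isCompact_univ_pi fun _ => isCompact_univ_pi fun _ => isCompact_Icc
  refine isCompact_iff_compactSpace.mp (IsCompact.of_isClosed_subset hbox hclosed ?_)
  intro U hU i _ j _
  exact abs_le.mp (by simpa using entry_norm_bound_of_unitary (𝕜 := ℝ) hU i j)

/-- The Borel σ-algebra on `O(d)`. -/
instance orthogonalGroup_measurableSpace (d : ℕ) :
    MeasurableSpace (Matrix.orthogonalGroup (Fin d) ℝ) := borel _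

instance orthogonalGroup_borelSpace (d : ℕ) :
    BorelSpace (Matrix.orthogonalGroup (Fin d) ℝ) := ⟨rfl⟩

/-- The uniform probability distribution on `O(d)`: Haar measure of total mass one. -/
def uniformOrthogonal (d : ℕ) : Measure (Matrix.orthogonalGroup (Fin d) ℝ) :=
  Measure.haarMeasure ⊤

/-- `ρ` times the first `N` columns of the orthogonal matrix `U`, as points of `ℝ^d`. -/
def scaledColumns {d N : ℕ} (hN : N ≤ d) (ρ : ℝ) (U : Matrix.orthogonalGroup (Fin d) ℝ) :
    Fin N → EuclideanSpace ℝ (Fin d) :=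
  fun i => WithLp.toLp 2 fun k => ρ * (U : Matrix (Fin d) (Fin d) ℝ) k (Fin.castLE hN i)

/-- The uniform distribution over the sequences `x₁, …, x_N` of pairwise orthogonal points of the
sphere of radius `ρ` about the origin of `ℝ^d` (where `N ≤ d`): the law of the first `N` columns
of a uniformly random orthogonal matrix, multiplied by `ρ`. -/
def uniformOrthogonalFrame {d N : ℕ} (hN : N ≤ d) (ρ : ℝ) :
    Measure (Fin N → EuclideanSpace ℝ (Fin d)) :=
  (uniformOrthogonal d).map (scaledColumns hN ρ)

/-- `f` is the biased nearest neighbour function with bias `b`: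
`f(x₁, …, x_N; y) = argmin_{x_i} (‖x_i - y‖² + b_i)`, whichever minimiser is chosen at a tie. -/
def IsBiasedNearestNeighbor {d N : ℕ} (b : Fin N → ℝ)
    (f : (Fin N → EuclideanSpace ℝ (Fin d)) → EuclideanSpace ℝ (Fin d) →
      EuclideanSpace ℝ (Fin d)) : Prop :=
  ∀ X y, ∃ i, f X y = X i ∧ ∀ j, ‖X i - y‖ ^ 2 + b i ≤ ‖X j - y‖ ^ 2 + b j

/-- A biased nearest neighbour function exists for every bias. -/
theorem exists_isBiasedNearestNeighbor {d N : ℕ} [NeZero N] (b : Fin N → ℝ) :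
    ∃ f : (Fin N → EuclideanSpace ℝ (Fin d)) → EuclideanSpace ℝ (Fin d) →
      EuclideanSpace ℝ (Fin d), IsBiasedNearestNeighbor b f := by
  have h : ∀ (X : Fin N → EuclideanSpace ℝ (Fin d)) (y : EuclideanSpace ℝ (Fin d)),
      ∃ i, ∀ j, ‖X i - y‖ ^ 2 + b i ≤ ‖X j - y‖ ^ 2 + b j := fun X y =>
    Finite.exists_min fun i => ‖X i - y‖ ^ 2 + b i
  choose g hg using h
  exact ⟨fun X y => X (g X y), fun X y => ⟨g X y, rfl, hg X y⟩⟩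

/-- A (generalized) attention head of rank `r` on `N` target points in `ℝ^d`,
`(X, y) ↦ V X φ(K X, y)`. The matrix `K` has rank at most `r`; its number `k` of rows is free, which
covers both `r × d` and `d × d` matrices. The attention map `φ` is any (measurable) function with
values in the probability simplex. -/
structure AttentionHead (d N r : ℕ) where
  /-- the output matrix -/
  V : Matrix (Fin d) (Fin d) ℝ
  /-- the number of rows of the key matrix -/
  k : ℕ
  /-- the key matrix -/
  K : Matrix (Fin k) (Fin d) ℝ
  rank_le : K.rank ≤ r
  /-- the attention map, a function of `K X = (K x₁, …, K x_N)` and `y` -/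
  φ : (Fin N → Fin k → ℝ) → EuclideanSpace ℝ (Fin d) → Fin N → ℝ
  measurable_φ : Measurable (Function.uncurry φ)
  φ_mem : ∀ Z y, φ Z y ∈ stdSimplex ℝ (Fin N)

namespace AttentionHead

/-- The output `V X φ(K X, y) = V (∑ i, φ_i(K X, y) x_i)` of the head. -/
def output {d N r : ℕ} (g : AttentionHead d N r) (X : Fin N → EuclideanSpace ℝ (Fin d))
    (y : EuclideanSpace ℝ (Fin d)) : EuclideanSpace ℝ (Fin d) :=
  Matrix.toEuclideanCLM (𝕜 := ℝ) g.V
    (∑ i, g.φ (fun j => g.K *ᵥ (X j).ofLp) y i • X i)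

/-- The operator norm (largest singular value) of the output matrix of the head. -/
def weightNorm {d N r : ℕ} (g : AttentionHead d N r) : ℝ :=
  ‖Matrix.toEuclideanCLM (𝕜 := ℝ) g.V‖

end AttentionHead

end

/-! Take bias 0 and put u = x₁ - x₂. The points have equal norm, so the nearest one is decided by
the sign of ⟨u, y⟩. Both the target and the heads are tested against the rapidly oscillating field
sin(a⟨u, y⟩) u.

The target has a polynomially large correlation with it. The jump of f cancels the oddness of the
sine and leaves ρ² sin(a|⟨u, y⟩|) (`IsBiasedNearestNeighbor.inner_sub_mul_sin`). Because of the kink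
of |z| at 0, its Gaussian mean decays only like the inverse of the frequency
(`le_integral_sin_abs_gaussianReal`).

A head has an exponentially small correlation with it (`abs_integral_inner_output_mul_sin_le`). The
kernel of K has dimension at least d - r. Flipping signs of coordinates of x₁, x₂ along an
orthonormal basis of that kernel changes neither the law nor the weights φ(KX, y). The wave may
therefore be replaced by its average over all flips, and of φ only |φ_i| ≤ 1 is then needed. Waves
with distant frequency vectors are nearly orthogonal under Gaussian y, so the second moment of the
average is at most a constant times a product with one factor per kernel coordinate
(`integral_signFlip_average_sq_le`). Comparing the uniform direction of u with a Gaussian vector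
bounds the mean of this product by 2(3/4)^m, where m is the number of flipped coordinates
(`integral_prod_exp_orthogonal_le`).

Expanding the squared distance to a small multiple of the test field turns the two estimates into
the lower bound (`le_integral_norm_sub_sum_output_sq`). -/

noncomputable section

/-! ### Integrals against the standard Gaussian of a Euclidean space -/

section StdGaussian

variable {E : Type*} [NormedAddCommGroup E] [InnerProductSpace ℝ E] [FiniteDimensional ℝ E]
  [MeasurableSpace E] [BorelSpace E]

theorem integral_cos_inner_stdGaussian (p : E) :
    ∫ y, Real.cos (inner ℝ p y) ∂(stdGaussian E) = Real.exp (-‖p‖ ^ 2 / 2) := by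
  have h := charFun_stdGaussian p
  rw [charFun_apply] at h
  have h2 := congrArg Complex.re h
  have hint : Integrable (fun y : E => Complex.exp ((inner ℝ y p : ℝ) * Complex.I))
      (stdGaussian E) := by
    refine Integrable.of_bound (by fun_prop) 1 (Filter.Eventually.of_forall fun y => ?_)
    rw [Complex.norm_exp_ofReal_mul_I]
  have h3 := integral_re (𝕜 := ℂ) hint
  simp only [RCLike.re_to_complex, Complex.exp_ofReal_mul_I_re] at h3
  rw [← h3] at h2
  simp_rw [real_inner_comm p] at h2 ⊢
  rw [h2]
  norm_cast

theorem map_inner_stdGaussian (u : E) :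
    (stdGaussian E).map (fun y => inner ℝ u y) =
      (gaussianReal 0 1).map (fun z => ‖u‖ * z) := by
  apply Measure.ext_of_charFun
  ext t
  rw [charFun_apply_real, integral_map (by fun_prop) (by fun_prop)]
  rw [gaussianReal_map_const_mul, charFun_gaussianReal]
  have h := charFun_stdGaussian (t • u)
  rw [charFun_apply] at h
  convert h using 1
  · simp_rw [inner_smul_right, real_inner_comm u]
    simp
  · simp only [norm_smul, Complex.ofReal_mul, mul_pow, Real.norm_eq_abs, ← Complex.ofReal_pow,
      sq_abs]
    simp
    ring_nf

theorem integral_comp_inner_stdGaussian (u : E) {f : ℝ → ℝ} (hf : Measurable f) :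
    ∫ y, f (inner ℝ u y) ∂(stdGaussian E) = ∫ z, f (‖u‖ * z) ∂(gaussianReal 0 1) := by
  rw [← integral_map (f := f) (φ := fun y : E => inner ℝ u y) (by fun_prop)
    hf.aestronglyMeasurable, map_inner_stdGaussian, integral_map (by fun_prop)
    hf.aestronglyMeasurable]

/-- Used to show that ties between the two points have probability zero. -/
theorem stdGaussian_inner_eq_zero {u : E} (hu : u ≠ 0) :
    stdGaussian E {y | inner ℝ u y = 0} = 0 := by
  have h := Measure.map_apply (μ := stdGaussian E) (f := fun y : E => inner ℝ u y)
    (by fun_prop) (measurableSet_singleton (0 : ℝ))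
  have hset : {y : E | inner ℝ u y = 0} = (fun y : E => inner ℝ u y) ⁻¹' {0} := rfl
  rw [hset, ← h, map_inner_stdGaussian, gaussianReal_map_const_mul]
  have hv : (NNReal.mk (‖u‖ ^ 2) (sq_nonneg _) * 1 : NNReal) ≠ 0 := by
    intro h0
    have := congrArg NNReal.toReal h0
    simp at this
    exact hu this
  have := nullSingletonClass_gaussianReal (μ := ‖u‖ * 0) hv
  exact measure_singleton 0

/-- The coordinates in any orthonormal basis are independent standard normals. -/
theorem integral_prod_inner_stdGaussian {ι : Type*} [Fintype ι] (b : OrthonormalBasis ι ℝ E)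
    (S : Finset ι) {k : ℝ → ℝ} (hk : Measurable k) :
    ∫ y, ∏ i ∈ S, k (inner ℝ (b i) y) ∂(stdGaussian E) =
      (∫ z, k z ∂(gaussianReal 0 1)) ^ S.card := by
  classical
  rw [stdGaussian_eq_map_pi_orthonormalBasis b, integral_map
    (Measurable.aemeasurable (by fun_prop))]
  · have h1 : ∀ x : ι → ℝ, ∏ i ∈ S, k (inner ℝ (b i) (∑ j, x j • b j)) =
        ∏ i, (fun i z => if i ∈ S then k z else 1) i (x i) := by
      intro x
      rw [Finset.prod_ite_mem, Finset.univ_inter]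
      refine Finset.prod_congr rfl fun i _ => ?_
      rw [b.orthonormal.inner_right_fintype]
    simp_rw [h1]
    rw [integral_fintype_prod_eq_prod (μ := fun _ : ι => gaussianReal 0 1)
      (fun i z => if i ∈ S then k z else 1)]
    have h2 : ∀ i, ∫ z, (if i ∈ S then k z else 1) ∂(gaussianReal 0 1) =
        if i ∈ S then ∫ z, k z ∂(gaussianReal 0 1) else 1 := by
      intro i
      split_ifs <;> simp
    simp_rw [h2]
    rw [Finset.prod_ite_mem, Finset.univ_inter, Finset.prod_const]
  · exact (Finset.measurable_prod _ fun i _ => hk.comp (by fun_prop)).aestronglyMeasurable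

theorem integral_sq_gaussianReal_zero_one : ∫ z, z ^ 2 ∂(gaussianReal 0 1) = 1 := by
  have h := variance_id_gaussianReal (μ := 0) (v := 1)
  rw [variance_of_integral_eq_zero (by fun_prop) (by simp)] at h
  simpa using h

theorem integrable_sq_gaussianReal_zero_one :
    Integrable (fun z : ℝ => z ^ 2) (gaussianReal 0 1) :=
  (IsGaussian.memLp_two_id (μ := gaussianReal 0 1)).integrable_sq

theorem integrable_norm_sq_stdGaussian : Integrable (fun y : E => ‖y‖ ^ 2) (stdGaussian E) :=
  (IsGaussian.memLp_two_id (μ := stdGaussian E)).integrable_norm_pow (by norm_num)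

theorem integral_norm_sq_stdGaussian :
    ∫ y, ‖y‖ ^ 2 ∂(stdGaussian E) = Module.finrank ℝ E := by
  have hb := fun y : E => (stdOrthonormalBasis ℝ E).sum_sq_inner_right y
  simp_rw [← hb]
  have h1 : ∀ i, ∫ y, (inner ℝ (stdOrthonormalBasis ℝ E i) y) ^ 2 ∂(stdGaussian E) = 1 := by
    intro i
    rw [integral_comp_inner_stdGaussian (f := fun z => z ^ 2) _ (by fun_prop)]
    simpa using integral_sq_gaussianReal_zero_one
  rw [integral_finsetSum]
  · simp [h1]
  · intro i _
    refine integrable_norm_sq_stdGaussian.mono' (by fun_prop)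
      (Filter.Eventually.of_forall fun y => ?_)
    rw [Real.norm_of_nonneg (sq_nonneg _)]
    have := abs_real_inner_le_norm (stdOrthonormalBasis ℝ E i) y
    rw [(stdOrthonormalBasis ℝ E).norm_eq_one, one_mul] at this
    exact sq_le_sq' (by linarith [abs_le.1 this]) (abs_le.1 this).2

end StdGaussian

/-! ### One-dimensional Gaussian integrals -/

theorem integral_exp_neg_sq_gaussianReal :
    ∫ z, Real.exp (-(3 / 2) * z ^ 2) ∂(gaussianReal 0 1) = 1 / 2 := by
  rw [integral_gaussianReal_eq_integral_smul one_ne_zero]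
  have h : ∀ z : ℝ, gaussianPDFReal 0 1 z • Real.exp (-(3 / 2) * z ^ 2) =
      (√(2 * Real.pi))⁻¹ * Real.exp (-2 * z ^ 2) := by
    intro z
    simp only [gaussianPDFReal, smul_eq_mul, NNReal.coe_one, mul_one, sub_zero]
    rw [mul_assoc, ← Real.exp_add]
    ring_nf
  simp_rw [h]
  rw [integral_const_mul, integral_gaussian]
  have h4 : 2 * Real.pi = 2 ^ 2 * (Real.pi / 2) := by ring
  rw [h4, Real.sqrt_mul (by positivity), Real.sqrt_sq (by norm_num)]
  have : √(Real.pi / 2) ≠ 0 := (Real.sqrt_pos.2 (by positivity)).ne'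
  field_simp

/-- The coefficient 3/2 makes 𝔼 exp(-3z²/2) = (1 + 3)^(-1/2) rational. This value 3/4 becomes the
decay factor per kernel coordinate. -/
theorem integral_half_one_add_exp_gaussianReal :
    ∫ z, (1 + Real.exp (-(3 / 2) * z ^ 2)) / 2 ∂(gaussianReal 0 1) = 3 / 4 := by
  rw [integral_div, integral_add (by simp), integral_exp_neg_sq_gaussianReal]
  · simp; norm_num
  · refine Integrable.of_bound (by fun_prop) 1 (Filter.Eventually.of_forall fun z => ?_)
    rw [Real.norm_of_nonneg (Real.exp_pos _).le, Real.exp_le_one_iff]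
    nlinarith [sq_nonneg z]

/-- Integrating by parts: `𝔼 sin(w|z|) (1 + (z² - 1)/w²) = 2 φ(0) / w` for a standard normal `z`
with density `φ`. -/
theorem integral_sin_abs_mul_gaussianReal {w : ℝ} (hw : 0 < w) :
    ∫ z, Real.sin (w * |z|) * (1 + (z ^ 2 - 1) / w ^ 2) ∂(gaussianReal 0 1) =
      2 * (√(2 * Real.pi))⁻¹ / w := by
  set f : ℝ → ℝ := fun z => (√(2 * Real.pi))⁻¹ * Real.exp (-z ^ 2 / 2) *
    (Real.sin (w * z) * (1 + (z ^ 2 - 1) / w ^ 2)) with hf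
  rw [integral_gaussianReal_eq_integral_smul one_ne_zero]
  have h : ∀ z : ℝ, gaussianPDFReal 0 1 z • (Real.sin (w * |z|) * (1 + (z ^ 2 - 1) / w ^ 2)) =
      f |z| := by
    intro z
    simp only [gaussianPDFReal, smul_eq_mul, NNReal.coe_one, mul_one, sub_zero, hf, sq_abs]
  simp_rw [h]
  rw [integral_comp_abs]
  -- An antiderivative of `f` that vanishes at infinity. The integral is -2 `A 0`, and only the
  -- cosine term survives at 0.
  set A : ℝ → ℝ := fun z => -(√(2 * Real.pi))⁻¹ * (Real.exp (-z ^ 2 / 2) *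
    (Real.cos (w * z) / w + z * Real.sin (w * z) / w ^ 2)) with hA
  have hexp : ∀ z : ℝ, HasDerivAt (fun z : ℝ => Real.exp (-z ^ 2 / 2))
      (Real.exp (-z ^ 2 / 2) * (-z)) z := by
    intro z
    have : HasDerivAt (fun z : ℝ => -z ^ 2 / 2) (-z) z := by
      refine ((hasDerivAt_pow 2 z).neg.div_const 2).congr_deriv ?_
      norm_num
      ring
    exact this.exp
  have hlin : ∀ z : ℝ, HasDerivAt (fun z : ℝ => w * z) w z := by
    intro z
    simpa using (hasDerivAt_id z).const_mul w
  have hderiv : ∀ z, HasDerivAt A (f z) z := by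
    intro z
    have h1 := ((hexp z).mul (((hlin z).cos.div_const w).add
      (((hasDerivAt_id z).mul (hlin z).sin).div_const (w ^ 2)))).const_mul (-(√(2 * Real.pi))⁻¹)
    refine h1.congr_deriv ?_
    simp only [hf, id, Pi.add_apply, Pi.mul_apply]
    field_simp
    ring
  have hfint : Integrable f := by
    have hb : Integrable (fun z : ℝ => (√(2 * Real.pi))⁻¹ * (1 + 1 / w ^ 2) *
        Real.exp (-(1 / 2) * z ^ 2) + (√(2 * Real.pi))⁻¹ / w ^ 2 *
          (z ^ (2 : ℝ) * Real.exp (-(1 / 2) * z ^ 2))) := by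
      refine Integrable.add ?_ ?_
      · exact (integrable_exp_neg_mul_sq (by norm_num)).const_mul _
      · exact (integrable_rpow_mul_exp_neg_mul_sq (by norm_num) (by norm_num)).const_mul _
    refine hb.mono' (by simp only [hf]; fun_prop) (Filter.Eventually.of_forall fun z => ?_)
    simp only [hf]
    rw [norm_mul, norm_mul, norm_mul, Real.norm_of_nonneg (by positivity : 0 ≤ (√(2 * Real.pi))⁻¹),
      Real.norm_of_nonneg (Real.exp_pos _).le]
    have hs : ‖Real.sin (w * z)‖ ≤ 1 := Real.abs_sin_le_one _
    have ht : ‖1 + (z ^ 2 - 1) / w ^ 2‖ ≤ 1 + 1 / w ^ 2 + z ^ 2 / w ^ 2 := by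
      rw [Real.norm_eq_abs, abs_le, sub_div]
      have h1 : 0 ≤ 1 / w ^ 2 := by positivity
      have h2 : 0 ≤ z ^ 2 / w ^ 2 := by positivity
      constructor <;> linarith
    have he : -z ^ 2 / 2 = -(1 / 2) * z ^ 2 := by ring
    rw [he, Real.rpow_ofNat]
    calc _ ≤ (√(2 * Real.pi))⁻¹ * Real.exp (-(1 / 2) * z ^ 2) *
          (1 * (1 + 1 / w ^ 2 + z ^ 2 / w ^ 2)) := by gcongr
      _ = _ := by ring
  have hlim : Filter.Tendsto A Filter.atTop (nhds 0) := by
    have h1 : Filter.Tendsto (fun z : ℝ => z ^ (1 : ℝ) * Real.exp (-(1 / 2) * z ^ 2))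
        Filter.atTop (nhds 0) := by
      have := (rpow_mul_exp_neg_mul_sq_isLittleO_exp_neg (b := 1 / 2) (by norm_num) 1).trans
        (g := fun z => Real.exp (-(1 / 2) * z)) (k := fun _ : ℝ => (1 : ℝ)) ?_
      · simpa using this.tendsto_div_nhds_zero
      · rw [Asymptotics.isLittleO_one_iff]
        exact Real.tendsto_exp_atBot.comp
          (Filter.Tendsto.const_mul_atTop_of_neg (by norm_num) Filter.tendsto_id)
    have h2 : Filter.Tendsto (fun z : ℝ => (√(2 * Real.pi))⁻¹ * (1 / w + 1 / w ^ 2) *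
        (z ^ (1 : ℝ) * Real.exp (-(1 / 2) * z ^ 2))) Filter.atTop (nhds 0) := by
      simpa only [mul_zero] using h1.const_mul ((√(2 * Real.pi))⁻¹ * (1 / w + 1 / w ^ 2))
    refine squeeze_zero_norm' ?_ h2
    filter_upwards [Filter.eventually_ge_atTop 1] with z hz
    simp only [hA]
    rw [norm_mul, norm_mul, norm_neg, Real.norm_of_nonneg (by positivity : 0 ≤ (√(2 * Real.pi))⁻¹),
      Real.norm_of_nonneg (Real.exp_pos _).le, Real.rpow_one]
    have hz0 : 0 ≤ z := by linarith
    have ht : ‖Real.cos (w * z) / w + z * Real.sin (w * z) / w ^ 2‖ ≤ z * (1 / w + 1 / w ^ 2) := by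
      refine (norm_add_le _ _).trans ?_
      rw [norm_div, norm_div, norm_mul, Real.norm_of_nonneg hw.le, Real.norm_of_nonneg hz0,
        Real.norm_of_nonneg (sq_nonneg w)]
      have hc : ‖Real.cos (w * z)‖ ≤ 1 := Real.abs_cos_le_one _
      have hs : ‖Real.sin (w * z)‖ ≤ 1 := Real.abs_sin_le_one _
      calc _ ≤ z / w + z * 1 / w ^ 2 := by gcongr; linarith
        _ = _ := by ring
    have he : -z ^ 2 / 2 = -(1 / 2) * z ^ 2 := by ring
    rw [he]
    calc _ ≤ (√(2 * Real.pi))⁻¹ * (Real.exp (-(1 / 2) * z ^ 2) * (z * (1 / w + 1 / w ^ 2))) := by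
          gcongr
      _ = _ := by ring
  rw [integral_Ioi_of_hasDerivAt_of_tendsto' (fun z _ => hderiv z) hfint.integrableOn hlim]
  simp [hA]
  ring

theorem le_integral_sin_abs_gaussianReal {w : ℝ} (hw : 0 < w) :
    2 * (√(2 * Real.pi))⁻¹ / w - 2 / w ^ 2 ≤ ∫ z, Real.sin (w * |z|) ∂(gaussianReal 0 1) := by
  have hs : Integrable (fun z : ℝ => Real.sin (w * |z|)) (gaussianReal 0 1) :=
    Integrable.of_bound (by fun_prop) 1 (Filter.Eventually.of_forall fun z => Real.abs_sin_le_one _)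
  have hq : Integrable (fun z : ℝ => (z ^ 2 + 1) / w ^ 2) (gaussianReal 0 1) :=
    (integrable_sq_gaussianReal_zero_one.add (integrable_const 1)).div_const _
  have hq2 : ∫ z : ℝ, (z ^ 2 + 1) / w ^ 2 ∂(gaussianReal 0 1) = 2 / w ^ 2 := by
    rw [integral_div, integral_add integrable_sq_gaussianReal_zero_one (integrable_const 1),
      integral_sq_gaussianReal_zero_one]
    simp
    norm_num
  rw [← integral_sin_abs_mul_gaussianReal hw, ← hq2, sub_le_iff_le_add, ← integral_add hs hq]
  -- The correction term in the exact identity costs at most 𝔼(z² + 1)/w² = 2/w².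
  have hpt : ∀ z : ℝ, |Real.sin (w * |z|) * ((z ^ 2 - 1) / w ^ 2)| ≤ (z ^ 2 + 1) / w ^ 2 := by
    intro z
    rw [abs_mul, abs_div, abs_of_nonneg (sq_nonneg w)]
    have h1 : |z ^ 2 - 1| ≤ z ^ 2 + 1 := by
      rw [abs_le]; constructor <;> nlinarith [sq_nonneg z]
    calc _ ≤ 1 * ((z ^ 2 + 1) / w ^ 2) := by
          gcongr
          exact Real.abs_sin_le_one _
      _ = _ := one_mul _
  refine integral_mono ?_ (hs.add hq) fun z => ?_
  · simp_rw [mul_add, mul_one]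
    exact hs.add (hq.mono' (by fun_prop) (Filter.Eventually.of_forall hpt))
  · have := (abs_le.1 (hpt z)).2
    linarith

/-- The variance of |M| is nonnegative. -/
theorem integral_abs_le_of_integral_sq_le {Ω : Type*} [MeasurableSpace Ω] {μ : Measure Ω}
    [IsProbabilityMeasure μ] {M : Ω → ℝ} (hM : MemLp M 2 μ) {D : ℝ} (hD : 0 ≤ D)
    (h : ∫ ω, M ω ^ 2 ∂μ ≤ D ^ 2) : ∫ ω, |M ω| ∂μ ≤ D := by
  have h1 := variance_nonneg (|M|) μ
  rw [variance_eq_sub hM.abs] at h1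
  simp only [Pi.pow_apply, Pi.abs_apply, sq_abs] at h1
  exact abs_le_of_sq_le_sq' (by linarith) hD |>.2

/-! ### Sign flips of coordinates, and bases adapted to a kernel -/

section SignFlip

variable {E ι : Type*} [NormedAddCommGroup E] [InnerProductSpace ℝ E] [Fintype ι]
  [DecidableEq ι]

/-- The isometry changing the sign of the coordinates in `S` that are selected by `ε`. -/
def signFlip (b : OrthonormalBasis ι ℝ E) (S : Finset ι) (ε : ι → Bool) : E ≃ₗᵢ[ℝ] E :=
  b.repr.trans ((LinearIsometryEquiv.piLpCongrRight 2 fun i =>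
    if i ∈ S ∧ ε i = true then LinearIsometryEquiv.neg ℝ else LinearIsometryEquiv.refl ℝ ℝ).trans
      b.repr.symm)

theorem inner_signFlip (b : OrthonormalBasis ι ℝ E) (S : Finset ι) (ε : ι → Bool) (i : ι) (x : E) :
    inner ℝ (b i) (signFlip b S ε x) =
      (if i ∈ S ∧ ε i = true then -1 else 1) * inner ℝ (b i) x := by
  rw [← b.repr_apply_apply, ← b.repr_apply_apply]
  simp only [signFlip, LinearIsometryEquiv.trans_apply, LinearIsometryEquiv.apply_symm_apply,
    LinearIsometryEquiv.piLpCongrRight_apply]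
  split_ifs <;> simp

theorem map_signFlip {F : Type*} [AddCommGroup F] [Module ℝ F] (b : OrthonormalBasis ι ℝ E)
    (S : Finset ι) (K : E →ₗ[ℝ] F) (hK : ∀ i ∈ S, K (b i) = 0) (ε : ι → Bool) (x : E) :
    K (signFlip b S ε x) = K x := by
  rw [← b.sum_repr' (signFlip b S ε x)]
  conv_rhs => rw [← b.sum_repr' x]
  simp only [map_sum, map_smul, inner_signFlip]
  refine Finset.sum_congr rfl fun i _ => ?_
  by_cases hi : i ∈ S
  · simp [hK i hi]
  · simp [hi]

theorem norm_signFlip_sub_sq (b : OrthonormalBasis ι ℝ E) (S : Finset ι) (ε ε' : ι → Bool)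
    (x : E) :
    ‖signFlip b S ε x - signFlip b S ε' x‖ ^ 2 =
      ∑ i, if i ∈ S ∧ ε i ≠ ε' i then 4 * inner ℝ (b i) x ^ 2 else 0 := by
  rw [← b.sum_sq_inner_right]
  refine Finset.sum_congr rfl fun i _ => ?_
  rw [inner_sub_right, inner_signFlip, inner_signFlip]
  by_cases hi : i ∈ S <;> cases ε i <;> cases ε' i <;> simp [hi] <;> ring

/-- The squared distance is a sum over the coordinates where ε and ε' differ, so the exponential
factorises. A coordinate in `S` contributes 1 + exp(…) to the sum over ε', and any other contributes
2. The result does not depend on ε. -/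
theorem sum_sum_exp_signFlip (b : OrthonormalBasis ι ℝ E) (S : Finset ι) (c : ℝ) (x : E) :
    ∑ ε, ∑ ε', Real.exp (-(c * ‖signFlip b S ε x - signFlip b S ε' x‖ ^ 2)) =
      (2 ^ Fintype.card ι) ^ 2 *
        ∏ i ∈ S, (1 + Real.exp (-(4 * c) * inner ℝ (b i) x ^ 2)) / 2 := by
  have h : ∀ ε : ι → Bool,
      ∑ ε' : ι → Bool, Real.exp (-(c * ‖signFlip b S ε x - signFlip b S ε' x‖ ^ 2)) =
      2 ^ Fintype.card ι * ∏ i ∈ S, (1 + Real.exp (-(4 * c) * inner ℝ (b i) x ^ 2)) / 2 := by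
    intro ε
    have h1 : ∀ ε' : ι → Bool, Real.exp (-(c * ‖signFlip b S ε x - signFlip b S ε' x‖ ^ 2)) =
        ∏ i, (fun i β => if i ∈ S ∧ ε i ≠ β then
          Real.exp (-(4 * c) * inner ℝ (b i) x ^ 2) else 1) i (ε' i) := by
      intro ε'
      rw [norm_signFlip_sub_sq, Finset.mul_sum, ← Finset.sum_neg_distrib, Real.exp_sum]
      refine Finset.prod_congr rfl fun i _ => ?_
      by_cases h : i ∈ S ∧ ε i ≠ ε' i
      · simp only [h, and_self, ne_eq, not_false_eq_true, if_true]
        congr 1; ring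
      · simp only [h, if_false, mul_zero, neg_zero, Real.exp_zero]
    simp_rw [h1]
    rw [← Fintype.piFinset_univ, ← Finset.prod_univ_sum (fun _ : ι => (Finset.univ : Finset Bool))
      (fun i β => if i ∈ S ∧ ε i ≠ β then Real.exp (-(4 * c) * inner ℝ (b i) x ^ 2) else 1),
      ← Finset.card_univ, ← Finset.prod_const,
      ← Finset.univ_inter S, ← Finset.prod_ite_mem, ← Finset.prod_mul_distrib]
    refine Finset.prod_congr rfl fun i _ => ?_
    by_cases hi : i ∈ S <;> cases ε i <;> simp [hi] <;> ring
  simp_rw [h]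
  rw [Finset.sum_const, Finset.card_univ, nsmul_eq_mul, Fintype.card_fun]
  simp
  ring

end SignFlip

/-- Rank-nullity: an orthonormal basis of the kernel, of dimension at least d - r, is extended to
the whole space. -/
theorem exists_orthonormalBasis_ker {d k r : ℕ} (K : Matrix (Fin k) (Fin d) ℝ) (hK : K.rank ≤ r) :
    ∃ (b : OrthonormalBasis (Fin d) ℝ (EuclideanSpace ℝ (Fin d))) (S : Finset (Fin d)),
      (∀ i ∈ S, K *ᵥ (b i).ofLp = 0) ∧ d ≤ S.card + r := by
  set L : EuclideanSpace ℝ (Fin d) →ₗ[ℝ] (Fin k → ℝ) :=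
    K.mulVecLin ∘ₗ (WithLp.linearEquiv 2 ℝ (Fin d → ℝ)).toLinearMap with hL
  have hrank : Module.finrank ℝ (LinearMap.range L) = K.rank := by
    rw [Matrix.rank, hL, LinearMap.range_comp_of_range_eq_top]
    exact LinearEquiv.range _
  have hsum := LinearMap.finrank_range_add_finrank_ker L
  rw [hrank, finrank_euclideanSpace_fin] at hsum
  set m := Module.finrank ℝ (LinearMap.ker L) with hm
  have hmd : m ≤ d := by omega
  set b₀ := stdOrthonormalBasis ℝ (LinearMap.ker L)
  set v : Fin d → EuclideanSpace ℝ (Fin d) := fun i =>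
    if h : (i : ℕ) < m then (b₀ ⟨i, h⟩ : EuclideanSpace ℝ (Fin d)) else 0 with hv
  set s : Set (Fin d) := {i | (i : ℕ) < m} with hs
  have hvs : Orthonormal ℝ (s.domRestrict v) := by
    have h1 : Orthonormal ℝ (fun j : s => (b₀ ⟨j.1, j.2⟩ : EuclideanSpace ℝ (Fin d))) := by
      have h2 := b₀.orthonormal.comp (fun j : s => (⟨j.1, j.2⟩ : Fin m)) (fun i j hij => by
        have := congrArg Fin.val hij
        exact Subtype.ext (Fin.ext this))
      exact h2.comp_linearIsometry (LinearMap.ker L).subtypeₗᵢ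
    convert h1 using 1
    ext1 j
    have hj : (j.1 : ℕ) < m := j.2
    simp [hv, Set.domRestrict, hj]
  obtain ⟨b, hb⟩ := hvs.exists_orthonormalBasis_extension_of_card_eq (by simp)
  refine ⟨b, Finset.univ.filter fun i => (i : ℕ) < m, fun i hi => ?_, ?_⟩
  · have him : (i : ℕ) < m := by simpa using hi
    rw [hb i him]
    simp only [hv, him, dif_pos]
    exact LinearMap.mem_ker.1 (b₀ ⟨i, him⟩).2
  · rw [Fin.card_filter_val_lt, min_eq_right hmd]
    omega

/-! ### Haar measure on the orthogonal group and comparison with a Gaussian vector -/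

section OrthogonalGroup

variable {d : ℕ}

instance isProbabilityMeasure_uniformOrthogonal (d : ℕ) :
    IsProbabilityMeasure (uniformOrthogonal d) := by
  constructor
  have := Measure.haarMeasure_self (K₀ := (⊤ : TopologicalSpace.PositiveCompacts
    (Matrix.orthogonalGroup (Fin d) ℝ)))
  simpa [uniformOrthogonal] using this

instance isHaarMeasure_uniformOrthogonal (d : ℕ) : (uniformOrthogonal d).IsHaarMeasure := by
  unfold uniformOrthogonal
  infer_instance

/-- Right translates are again Haar probability measures, hence equal by uniqueness. Consequently
the law of U x depends on x only through its norm. -/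
instance isMulRightInvariant_uniformOrthogonal (d : ℕ) :
    (uniformOrthogonal d).IsMulRightInvariant := by
  refine ⟨fun g => ?_⟩
  have : IsProbabilityMeasure ((uniformOrthogonal d).map (· * g)) :=
    Measure.isProbabilityMeasure_map (measurable_mul_const g).aemeasurable
  have : ((uniformOrthogonal d).map (· * g)).IsHaarMeasure :=
    Measure.isHaarMeasure_map_mul_right _ g
  exact Measure.isHaarMeasure_eq_of_isProbabilityMeasure _ _

instance secondCountableTopology_orthogonalGroup (d : ℕ) :
    SecondCountableTopology (Matrix.orthogonalGroup (Fin d) ℝ) := by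
  have : SecondCountableTopology (Matrix (Fin d) (Fin d) ℝ) :=
    inferInstanceAs (SecondCountableTopology (Fin d → Fin d → ℝ))
  exact TopologicalSpace.Subtype.secondCountableTopology _

/-- An orthogonal matrix as a linear isometry of Euclidean space. -/
def orthogonalIsometry (U : Matrix.orthogonalGroup (Fin d) ℝ) :
    EuclideanSpace ℝ (Fin d) ≃ₗᵢ[ℝ] EuclideanSpace ℝ (Fin d) :=
  Unitary.linearIsometryEquiv
    ⟨Matrix.toEuclideanCLM (n := Fin d) (𝕜 := ℝ) U, Unitary.map_mem _ U.2⟩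

theorem orthogonalIsometry_apply (U : Matrix.orthogonalGroup (Fin d) ℝ)
    (x : EuclideanSpace ℝ (Fin d)) :
    orthogonalIsometry U x = WithLp.toLp 2 ((U : Matrix (Fin d) (Fin d) ℝ) *ᵥ x.ofLp) :=
  rfl

theorem orthogonalIsometry_mul (U W : Matrix.orthogonalGroup (Fin d) ℝ)
    (x : EuclideanSpace ℝ (Fin d)) :
    orthogonalIsometry (U * W) x = orthogonalIsometry U (orthogonalIsometry W x) := by
  simp [orthogonalIsometry_apply]

/-- Lets sign flips and reflections act on the random matrix by multiplication. -/
theorem exists_orthogonalIsometry_eq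
    (Q : EuclideanSpace ℝ (Fin d) ≃ₗᵢ[ℝ] EuclideanSpace ℝ (Fin d)) :
    ∃ U : Matrix.orthogonalGroup (Fin d) ℝ, orthogonalIsometry U = Q := by
  have hmem : (Matrix.toEuclideanCLM (n := Fin d) (𝕜 := ℝ)).symm
      (Unitary.linearIsometryEquiv.symm Q : EuclideanSpace ℝ (Fin d) →L[ℝ] _) ∈
        unitary (Matrix (Fin d) (Fin d) ℝ) :=
    Unitary.map_mem (Matrix.toEuclideanCLM (n := Fin d) (𝕜 := ℝ)).symm
      (Unitary.linearIsometryEquiv.symm Q).2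
  refine ⟨⟨_, hmem⟩, ?_⟩
  ext1 x
  change Matrix.toEuclideanCLM (n := Fin d) (𝕜 := ℝ)
    ((Matrix.toEuclideanCLM (n := Fin d) (𝕜 := ℝ)).symm (Q : _ →L[ℝ] _)) x = Q x
  simp

theorem Continuous.orthogonalIsometry {α : Type*} [TopologicalSpace α]
    {f : α → Matrix.orthogonalGroup (Fin d) ℝ} {g : α → EuclideanSpace ℝ (Fin d)}
    (hf : Continuous f) (hg : Continuous g) :
    Continuous fun t => orthogonalIsometry (f t) (g t) := by
  simp only [orthogonalIsometry_apply]
  refine (PiLp.continuous_toLp 2 _).comp ?_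
  exact Continuous.matrix_mulVec (by fun_prop) (by fun_prop)

attribute [irreducible] orthogonalIsometry

theorem scaledColumns_eq {N : ℕ} (hN : N ≤ d) (ρ : ℝ) (U : Matrix.orthogonalGroup (Fin d) ℝ)
    (i : Fin N) :
    scaledColumns hN ρ U i =
      orthogonalIsometry U (ρ • EuclideanSpace.single (Fin.castLE hN i) (1 : ℝ)) := by
  ext k
  simp [scaledColumns, orthogonalIsometry_apply]

theorem measurable_scaledColumns {N : ℕ} (hN : N ≤ d) (ρ : ℝ) :
    Measurable (scaledColumns (d := d) hN ρ) := by
  refine measurable_pi_lambda _ fun i => ?_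
  simp_rw [scaledColumns_eq]
  exact (continuous_id.orthogonalIsometry continuous_const).measurable

/-- A Gaussian vector has a uniform direction and mean squared norm d. For a Gaussian vector the
product has mean (3/4)^|S| by independence; the factor 2 pays for the random length. -/
theorem integral_prod_exp_orthogonal_le (hd : 0 < d) {ι : Type*} [Fintype ι]
    (b : OrthonormalBasis ι ℝ (EuclideanSpace ℝ (Fin d))) (S : Finset ι)
    (w : EuclideanSpace ℝ (Fin d)) {c : ℝ} (hc : 3 * d ≤ c * ‖w‖ ^ 2) :
    ∫ U, ∏ i ∈ S, (1 + Real.exp (-c * inner ℝ (b i) (orthogonalIsometry U w) ^ 2)) / 2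
      ∂(uniformOrthogonal d) ≤ 2 * (3 / 4) ^ S.card := by
  have hd' : (0 : ℝ) < d := by exact_mod_cast hd
  have hw : 0 < ‖w‖ := by
    refine (norm_nonneg w).lt_of_ne fun h => ?_
    rw [← h] at hc
    norm_num at hc
    linarith
  have hc0 : 0 < c := by
    by_contra! h
    nlinarith [mul_nonneg_of_nonpos_of_nonpos h (neg_nonpos.2 (sq_nonneg ‖w‖))]
  set Φ : ℝ → EuclideanSpace ℝ (Fin d) → ℝ := fun l x =>
    ∏ i ∈ S, (1 + Real.exp (-l * inner ℝ (b i) x ^ 2)) / 2 with hΦ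
  have hΦc : ∀ l, Continuous (Φ l) := fun l => by
    simp only [hΦ]; fun_prop
  have hΦ0 : ∀ l x, 0 ≤ Φ l x := fun l x => Finset.prod_nonneg fun i _ => by positivity
  have hΦ1 : ∀ l x, 0 ≤ l → Φ l x ≤ 1 := fun l x hl =>
    Finset.prod_le_one (fun i _ => by positivity) fun i _ => by
      have : Real.exp (-l * inner ℝ (b i) x ^ 2) ≤ 1 := by
        rw [Real.exp_le_one_iff]
        nlinarith [mul_nonneg hl (sq_nonneg (inner ℝ (b i) x))]
      linarith
  have hUint : ∀ l x, 0 ≤ l → Integrable (fun U => Φ l (orthogonalIsometry U x))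
      (uniformOrthogonal d) := fun l x hl => by
    refine Integrable.of_bound (((hΦc l).comp
      (continuous_id.orthogonalIsometry continuous_const)).aestronglyMeasurable) 1
      (Filter.Eventually.of_forall fun U => ?_)
    rw [Real.norm_of_nonneg (hΦ0 _ _)]
    exact hΦ1 _ _ hl
  set I := ∫ U, Φ c (orthogonalIsometry U w) ∂(uniformOrthogonal d) with hI
  have hI0 : 0 ≤ I := integral_nonneg fun U => hΦ0 _ _
  -- A Markov-type comparison: the left side is nonpositive when ‖G‖² ≥ 2d and at most `I`
  -- otherwise, so no tail bound for ‖G‖ is needed.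
  have hpt : ∀ G : EuclideanSpace ℝ (Fin d), I * (1 - ‖G‖ ^ 2 / (2 * d)) ≤
      ∫ U, Φ (3 / 2) (orthogonalIsometry U G) ∂(uniformOrthogonal d) := by
    intro G
    by_cases hG : ‖G‖ ^ 2 ≤ 2 * d
    · set s := ‖G‖ / ‖w‖ with hs
      have hnorm : ‖s • w‖ = ‖G‖ := by
        rw [norm_smul, hs, norm_div, norm_norm, norm_norm, div_mul_cancel₀ _ hw.ne']
      -- The reflection exchanging two vectors of equal norm.
      obtain ⟨W, hW⟩ := exists_orthogonalIsometry_eq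
        (Submodule.reflection (ℝ ∙ (s • w - G))ᗮ)
      have hWG : orthogonalIsometry W (s • w) = G := by
        rw [hW]; exact Submodule.reflection_sub hnorm
      have h1 : ∫ U, Φ (3 / 2) (orthogonalIsometry U G) ∂(uniformOrthogonal d) =
          ∫ U, Φ (3 / 2) (orthogonalIsometry U (s • w)) ∂(uniformOrthogonal d) := by
        rw [← integral_mul_right_eq_self (μ := uniformOrthogonal d)
          (fun U => Φ (3 / 2) (orthogonalIsometry U (s • w))) W]
        simp_rw [orthogonalIsometry_mul, hWG]
      have h2 : I ≤ ∫ U, Φ (3 / 2) (orthogonalIsometry U G) ∂(uniformOrthogonal d) := by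
        rw [h1]
        refine integral_mono (hUint _ _ hc0.le) (hUint _ _ (by norm_num)) fun U => ?_
        refine Finset.prod_le_prod (fun i _ => by positivity) fun i _ => ?_
        rw [map_smul, inner_smul_right]
        -- Here ‖G‖² ≤ 2d gives (3/2)‖G‖² ≤ 3d ≤ c‖w‖².
        have hs2 : 3 / 2 * s ^ 2 ≤ c := by
          rw [hs, div_pow, ← mul_div_assoc, div_le_iff₀ (by positivity)]
          linarith
        have := mul_le_mul_of_nonneg_right hs2
          (sq_nonneg (inner ℝ (b i) (orthogonalIsometry U w)))
        have : Real.exp (-c * inner ℝ (b i) (orthogonalIsometry U w) ^ 2) ≤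
            Real.exp (-(3 / 2) * (s * inner ℝ (b i) (orthogonalIsometry U w)) ^ 2) := by
          rw [Real.exp_le_exp]
          linarith
        linarith
      refine le_trans ?_ h2
      have : 0 ≤ ‖G‖ ^ 2 / (2 * d) := by positivity
      nlinarith
    · refine le_trans ?_ (integral_nonneg fun U => hΦ0 _ _)
      refine mul_nonpos_of_nonneg_of_nonpos hI0 ?_
      rw [sub_nonpos, one_le_div (by positivity)]
      linarith
  have hint2 : Integrable (fun p : EuclideanSpace ℝ (Fin d) × Matrix.orthogonalGroup (Fin d) ℝ =>
      Φ (3 / 2) (orthogonalIsometry p.2 p.1))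
      ((stdGaussian (EuclideanSpace ℝ (Fin d))).prod (uniformOrthogonal d)) := by
    refine Integrable.of_bound (((hΦc _).comp
      (continuous_snd.orthogonalIsometry continuous_fst)).aestronglyMeasurable) 1
      (Filter.Eventually.of_forall fun U => ?_)
    rw [Real.norm_of_nonneg (hΦ0 _ _)]
    exact hΦ1 _ _ (by norm_num)
  have hnormint : Integrable (fun G : EuclideanSpace ℝ (Fin d) => ‖G‖ ^ 2 / (2 * d))
      (stdGaussian (EuclideanSpace ℝ (Fin d))) := integrable_norm_sq_stdGaussian.div_const _
  have hleft : ∫ G : EuclideanSpace ℝ (Fin d), I * (1 - ‖G‖ ^ 2 / (2 * d))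
      ∂(stdGaussian (EuclideanSpace ℝ (Fin d))) = I / 2 := by
    rw [integral_const_mul, integral_sub (integrable_const _) hnormint, integral_div,
      integral_norm_sq_stdGaussian, finrank_euclideanSpace_fin]
    simp
    field_simp
    norm_num
  have hle := integral_mono (((integrable_const 1).sub hnormint).const_mul I)
    hint2.integral_prod_left hpt
  simp only [Pi.sub_apply] at hle
  rw [hleft, integral_integral_swap hint2] at hle
  -- For fixed U, the inverse rotation carries b to another orthonormal basis, so the Gaussian
  -- integral does not depend on U.
  have hright : ∀ U : Matrix.orthogonalGroup (Fin d) ℝ,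
      ∫ G, Φ (3 / 2) (orthogonalIsometry U G) ∂(stdGaussian (EuclideanSpace ℝ (Fin d))) =
        (3 / 4) ^ S.card := by
    intro U
    have h := integral_prod_inner_stdGaussian (b.map (orthogonalIsometry U).symm) S
      (k := fun z => (1 + Real.exp (-(3 / 2) * z ^ 2)) / 2) (by fun_prop)
    rw [integral_half_one_add_exp_gaussianReal] at h
    rw [← h]
    simp only [hΦ, OrthonormalBasis.map_apply]
    simp_rw [LinearIsometryEquiv.inner_map_eq_flip, LinearIsometryEquiv.symm_symm]
  simp_rw [hright] at hle
  simp at hle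
  linarith

end OrthogonalGroup

/-! ### Second moment of the wave averaged over sign flips -/

theorem sum_mul_sin_sq_le {κ : Type*} (s : Finset κ) (c t : κ → ℝ) :
    (∑ k ∈ s, c k * Real.sin (t k)) ^ 2 ≤
      ∑ k ∈ s, ∑ l ∈ s, c k * c l * Real.cos (t k - t l) := by
  -- The double sum is |∑ c_k exp(i t_k)|²; the sine sum is its imaginary part.
  have h : ∑ k ∈ s, ∑ l ∈ s, c k * c l * Real.cos (t k - t l) =
      (∑ k ∈ s, c k * Real.cos (t k)) ^ 2 + (∑ k ∈ s, c k * Real.sin (t k)) ^ 2 := by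
    rw [sq, sq, Finset.sum_mul_sum, Finset.sum_mul_sum, ← Finset.sum_add_distrib]
    refine Finset.sum_congr rfl fun k _ => ?_
    rw [← Finset.sum_add_distrib]
    refine Finset.sum_congr rfl fun l _ => ?_
    rw [Real.cos_sub]
    ring
  rw [h]
  linarith [sq_nonneg (∑ k ∈ s, c k * Real.cos (t k))]

/-- The exponential rate at which the correlations decay in the codimension of the rank. -/
def decayRate : ℝ := Real.log (4 / 3) / 2

theorem decayRate_pos : 0 < decayRate := div_pos (Real.log_pos (by norm_num)) two_pos

/-- The halved logarithm in `decayRate` reflects the square root taken in passing from second to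
first absolute moments. -/
theorem exp_neg_decayRate_mul_sq (m : ℕ) :
    Real.exp (-(decayRate * m)) ^ 2 = (3 / 4) ^ m := by
  rw [← Real.exp_nat_mul, decayRate]
  have : ((2 : ℕ) : ℝ) * -(Real.log (4 / 3) / 2 * m) = m * -Real.log (4 / 3) := by
    push_cast; ring
  rw [this, Real.exp_nat_mul, ← Real.log_inv, Real.exp_log (by norm_num)]
  norm_num

section SignFlipAverage

variable {E ι : Type*} [NormedAddCommGroup E] [InnerProductSpace ℝ E] [FiniteDimensional ℝ E]
  [MeasurableSpace E] [BorelSpace E] [Fintype ι] [DecidableEq ι]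

/-- The coefficients α do not depend on y, so integrating the squared average leaves pairwise
Gaussian correlations exp(-a²‖x_ε - x_ε'‖²/2), which `sum_sum_exp_signFlip` sums. -/
theorem integral_signFlip_average_sq_le (b : OrthonormalBasis ι ℝ E) (S : Finset ι) (x : E) (a : ℝ)
    {α : (ι → Bool) → ℝ} {B : ℝ} (hα : ∀ ε, |α ε| ≤ B) :
    ∫ y, ((2 ^ Fintype.card ι)⁻¹ *
        ∑ ε, α ε * Real.sin (a * inner ℝ (signFlip b S ε x) y)) ^ 2 ∂(stdGaussian E) ≤
      B ^ 2 * ∏ i ∈ S, (1 + Real.exp (-(2 * a ^ 2) * inner ℝ (b i) x ^ 2)) / 2 := by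
  have hB0 : 0 ≤ B := (abs_nonneg _).trans (hα fun _ => true)
  set q : (ι → Bool) → E := fun ε => a • signFlip b S ε x with hq
  have hcos : ∀ p : E, Integrable (fun y => Real.cos (inner ℝ p y)) (stdGaussian E) := fun p =>
    Integrable.of_bound (by fun_prop) 1
      (Filter.Eventually.of_forall fun y => Real.abs_cos_le_one _)
  have hpt : ∀ y, ((2 ^ Fintype.card ι)⁻¹ *
      ∑ ε, α ε * Real.sin (a * inner ℝ (signFlip b S ε x) y)) ^ 2 ≤
      ((2 ^ Fintype.card ι) ^ 2)⁻¹ *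
        ∑ ε, ∑ ε', α ε * α ε' * Real.cos (inner ℝ (q ε - q ε') y) := by
    intro y
    have h1 := sum_mul_sin_sq_le Finset.univ α fun ε => a * inner ℝ (signFlip b S ε x) y
    rw [mul_pow, inv_pow]
    refine mul_le_mul_of_nonneg_left (h1.trans_eq ?_) (by positivity)
    refine Finset.sum_congr rfl fun ε _ => Finset.sum_congr rfl fun ε' _ => ?_
    simp only [hq, inner_sub_left, real_inner_smul_left]
  refine (integral_mono_of_nonneg (Filter.Eventually.of_forall fun y => sq_nonneg _) ?_
    (Filter.Eventually.of_forall hpt)).trans ?_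
  · exact (integrable_finsetSum _ fun ε _ => integrable_finsetSum _ fun ε' _ =>
      (hcos _).const_mul _).const_mul _
  rw [integral_const_mul, integral_finsetSum _ fun ε _ => integrable_finsetSum _
    fun ε' _ => (hcos _).const_mul _]
  have h2 : ∀ ε, ∫ y, ∑ ε', α ε * α ε' * Real.cos (inner ℝ (q ε - q ε') y) ∂(stdGaussian E) ≤
      ∑ ε', B ^ 2 * Real.exp (-(a ^ 2 / 2 * ‖signFlip b S ε x - signFlip b S ε' x‖ ^ 2)) := by
    intro ε
    rw [integral_finsetSum _ fun ε' _ => (hcos _).const_mul _]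
    refine Finset.sum_le_sum fun ε' _ => ?_
    rw [integral_const_mul, integral_cos_inner_stdGaussian]
    have h3 : -‖q ε - q ε'‖ ^ 2 / 2 =
        -(a ^ 2 / 2 * ‖signFlip b S ε x - signFlip b S ε' x‖ ^ 2) := by
      simp only [hq]
      rw [← smul_sub, norm_smul, mul_pow, Real.norm_eq_abs, sq_abs]
      ring
    rw [h3]
    refine mul_le_mul_of_nonneg_right ?_ (Real.exp_pos _).le
    refine (le_abs_self _).trans ?_
    rw [abs_mul, sq]
    exact mul_le_mul (hα _) (hα _) (abs_nonneg _) hB0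
  calc _ ≤ ((2 ^ Fintype.card ι) ^ 2)⁻¹ * ∑ ε, ∑ ε', B ^ 2 * Real.exp (-(a ^ 2 / 2 *
        ‖signFlip b S ε x - signFlip b S ε' x‖ ^ 2)) :=
        mul_le_mul_of_nonneg_left (Finset.sum_le_sum fun ε _ => h2 ε) (by positivity)
    _ = _ := by
        simp_rw [← Finset.mul_sum]
        rw [sum_sum_exp_signFlip]
        have h4 : 4 * (a ^ 2 / 2) = 2 * a ^ 2 := by ring
        rw [h4, ← mul_assoc, mul_comm _ (B ^ 2), mul_assoc,
          ← mul_assoc _ ((2 ^ Fintype.card ι) ^ 2 : ℝ), inv_mul_cancel₀ (by positivity), one_mul]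

end SignFlipAverage

/-! ### Correlation of one head with the test field -/

section HeadCorrelation

variable {d N r : ℕ}

theorem continuous_orthogonalIsometry_fst (x : EuclideanSpace ℝ (Fin d)) : Continuous
    fun p : Matrix.orthogonalGroup (Fin d) ℝ × EuclideanSpace ℝ (Fin d) =>
      orthogonalIsometry p.1 x :=
  continuous_fst.orthogonalIsometry continuous_const

theorem AttentionHead.measurable_weight (g : AttentionHead d N r)
    (v : Fin N → EuclideanSpace ℝ (Fin d)) (i : Fin N) : Measurable
    fun p : Matrix.orthogonalGroup (Fin d) ℝ × EuclideanSpace ℝ (Fin d) =>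
      g.φ (fun j => g.K *ᵥ (orthogonalIsometry p.1 (v j)).ofLp) p.2 i := by
  have h : Measurable fun p : Matrix.orthogonalGroup (Fin d) ℝ × EuclideanSpace ℝ (Fin d) =>
      ((fun j => g.K *ᵥ (orthogonalIsometry p.1 (v j)).ofLp, p.2) :
        (Fin N → Fin g.k → ℝ) × EuclideanSpace ℝ (Fin d)) := by
    refine Measurable.prodMk (measurable_pi_lambda _ fun j => ?_) measurable_snd
    exact (Continuous.matrix_mulVec continuous_const
      ((PiLp.continuous_ofLp 2 _).comp (continuous_orthogonalIsometry_fst (v j)))).measurable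
  exact (measurable_pi_apply i).comp (g.measurable_φ.comp h)

theorem AttentionHead.weight_mem_Icc (g : AttentionHead d N r) (Z : Fin N → Fin g.k → ℝ)
    (y : EuclideanSpace ℝ (Fin d)) (i : Fin N) : g.φ Z y i ∈ Set.Icc (0 : ℝ) 1 :=
  mem_Icc_of_mem_stdSimplex (g.φ_mem Z y) i

theorem integral_signFlip_average_sq_orthogonal_le (hd : 0 < d)
    (b : OrthonormalBasis (Fin d) ℝ (EuclideanSpace ℝ (Fin d))) (S : Finset (Fin d))
    (w : EuclideanSpace ℝ (Fin d)) {a : ℝ} (ha : 3 * d ≤ 2 * a ^ 2 * ‖w‖ ^ 2)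
    {α : (Fin d → Bool) → Matrix.orthogonalGroup (Fin d) ℝ → ℝ} {B : ℝ}
    (hα : ∀ ε U, |α ε U| ≤ B)
    (hint : Integrable (fun p : Matrix.orthogonalGroup (Fin d) ℝ × EuclideanSpace ℝ (Fin d) =>
      ((2 ^ d)⁻¹ * ∑ ε, α ε p.1 *
        Real.sin (a * inner ℝ (signFlip b S ε (orthogonalIsometry p.1 w)) p.2)) ^ 2)
      ((uniformOrthogonal d).prod (stdGaussian (EuclideanSpace ℝ (Fin d))))) :
    ∫ p, ((2 ^ d)⁻¹ * ∑ ε, α ε p.1 *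
        Real.sin (a * inner ℝ (signFlip b S ε (orthogonalIsometry p.1 w)) p.2)) ^ 2
      ∂((uniformOrthogonal d).prod (stdGaussian (EuclideanSpace ℝ (Fin d)))) ≤
      (B * √2 * Real.exp (-(decayRate * S.card))) ^ 2 := by
  have hw : Continuous fun U : Matrix.orthogonalGroup (Fin d) ℝ => orthogonalIsometry U w :=
    continuous_id.orthogonalIsometry continuous_const
  have hc : Continuous fun U : Matrix.orthogonalGroup (Fin d) ℝ =>
      ∏ i ∈ S, (1 + Real.exp (-(2 * a ^ 2) * inner ℝ (b i) (orthogonalIsometry U w) ^ 2)) / 2 := by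
    fun_prop
  have hcint : Integrable _ (uniformOrthogonal d) := hc.integrable_of_hasCompactSupport
    (HasCompactSupport.of_compactSpace _)
  rw [integral_prod _ hint]
  refine (integral_mono hint.integral_prod_left (hcint.const_mul (B ^ 2)) fun U => ?_).trans ?_
  · have h := integral_signFlip_average_sq_le b S (orthogonalIsometry U w) a fun ε => hα ε U
    simpa only [Fintype.card_fin] using h
  · rw [integral_const_mul, mul_pow, mul_pow, exp_neg_decayRate_mul_sq, Real.sq_sqrt two_pos.le,
      mul_assoc]
    exact mul_le_mul_of_nonneg_left (integral_prod_exp_orthogonal_le hd b S w ha) (sq_nonneg B)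

set_option maxHeartbeats 800000 in
/-- The random frame `U v₁, …, U v_N` and the oscillation along `U w` have a correlation with the
output of a head that is exponentially small in the dimension of the kernel of its key matrix. -/
theorem abs_integral_inner_output_mul_sin_le (hd : 0 < d) (g : AttentionHead d N r)
    (v : Fin N → EuclideanSpace ℝ (Fin d)) (w : EuclideanSpace ℝ (Fin d)) {a ρ : ℝ}
    (hρ : 0 ≤ ρ) (hv : ∀ i, ‖v i‖ ≤ ρ) (ha : 3 * d ≤ 2 * a ^ 2 * ‖w‖ ^ 2) :
    |∫ p, inner ℝ (orthogonalIsometry p.1 w)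
          (g.output (fun i => orthogonalIsometry p.1 (v i)) p.2) *
        Real.sin (a * inner ℝ (orthogonalIsometry p.1 w) p.2)
        ∂((uniformOrthogonal d).prod (stdGaussian (EuclideanSpace ℝ (Fin d))))| ≤
      N * (‖w‖ * ρ * g.weightNorm * √2 * Real.exp (-(decayRate * ((d : ℝ) - r)))) := by
  obtain ⟨b, S, hbS, hcard⟩ := exists_orthonormalBasis_ker g.K g.rank_le
  set μ := (uniformOrthogonal d).prod (stdGaussian (EuclideanSpace ℝ (Fin d))) with hμ
  set T := Matrix.toEuclideanCLM (n := Fin d) (𝕜 := ℝ) g.V with hT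
  set B := ‖w‖ * ρ * g.weightNorm with hB
  have hB0 : 0 ≤ B := by
    have : 0 ≤ g.weightNorm := norm_nonneg _
    positivity
  set m := S.card with hm
  set D := B * √2 * Real.exp (-(decayRate * m)) with hD
  have hD0 : 0 ≤ D := by positivity
  have hB2 : 0 ≤ B * √2 := by positivity
  have hKflip : ∀ (ε : Fin d → Bool) (x : EuclideanSpace ℝ (Fin d)),
      g.K *ᵥ (signFlip b S ε x).ofLp = g.K *ᵥ x.ofLp := fun ε x =>
    map_signFlip b S (g.K.mulVecLin ∘ₗ (WithLp.linearEquiv 2 ℝ (Fin d → ℝ)).toLinearMap) hbS ε x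
  choose R hR using fun ε : Fin d → Bool => exists_orthogonalIsometry_eq (signFlip b S ε)
  have hOc := continuous_orthogonalIsometry_fst (d := d)
  set A : Fin N → (Fin d → Bool) → Matrix.orthogonalGroup (Fin d) ℝ × EuclideanSpace ℝ (Fin d) → ℝ :=
      fun i ε p =>
    inner ℝ (signFlip b S ε (orthogonalIsometry p.1 w))
      (T (signFlip b S ε (orthogonalIsometry p.1 (v i)))) with hA
  set θ : (Fin d → Bool) → Matrix.orthogonalGroup (Fin d) ℝ × EuclideanSpace ℝ (Fin d) → ℝ :=
      fun ε p =>
    a * inner ℝ (signFlip b S ε (orthogonalIsometry p.1 w)) p.2 with hθ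
  set φ : Fin N → Matrix.orthogonalGroup (Fin d) ℝ × EuclideanSpace ℝ (Fin d) → ℝ := fun i p =>
      g.φ (fun j => g.K *ᵥ (orthogonalIsometry p.1 (v j)).ofLp) p.2 i with hφ
  have hAc : ∀ i ε, Continuous (A i ε) := fun i ε =>
    ((signFlip b S ε).continuous.comp (hOc w)).inner
      (T.continuous.comp ((signFlip b S ε).continuous.comp (hOc (v i))))
  have hθc : ∀ ε, Continuous (θ ε) := fun ε =>
    (((signFlip b S ε).continuous.comp (hOc w)).inner continuous_snd).const_mul a
  have hAB : ∀ i ε p, |A i ε p| ≤ B := by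
    intro i ε p
    refine (abs_real_inner_le_norm _ _).trans ?_
    rw [LinearIsometryEquiv.norm_map, LinearIsometryEquiv.norm_map, hB, mul_assoc, mul_comm ρ]
    gcongr
    refine (T.le_opNorm _).trans ?_
    rw [LinearIsometryEquiv.norm_map, LinearIsometryEquiv.norm_map]
    exact mul_le_mul_of_nonneg_left (hv i) (norm_nonneg _)
  have hφ0 : ∀ i p, |φ i p| ≤ 1 := fun i p => by
    rw [abs_of_nonneg (g.weight_mem_Icc _ _ i).1]
    exact (g.weight_mem_Icc _ _ i).2
  have hφm : ∀ i, Measurable (φ i) := g.measurable_weight v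
  set L : (Fin d → Bool) → Matrix.orthogonalGroup (Fin d) ℝ × EuclideanSpace ℝ (Fin d) → ℝ :=
      fun ε p =>
    ∑ i, φ i p * (A i ε p * Real.sin (θ ε p)) with hL
  have hterm : ∀ i ε p, |φ i p * (A i ε p * Real.sin (θ ε p))| ≤ B := fun i ε p => by
    rw [abs_mul, abs_mul]
    calc _ ≤ 1 * (B * 1) := by
          gcongr
          · exact hφ0 i p
          · exact hAB i ε p
          · exact Real.abs_sin_le_one _
      _ = B := by ring
  have htermm : ∀ i ε, Measurable fun p => φ i p * (A i ε p * Real.sin (θ ε p)) := fun i ε =>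
    (hφm i).mul ((hAc i ε).measurable.mul (Real.measurable_sin.comp (hθc ε).measurable))
  have hLm : ∀ ε, Measurable (L ε) := fun ε => Finset.measurable_sum _ fun i _ => htermm i ε
  have hLint : ∀ ε, Integrable (L ε) μ := fun ε =>
    integrable_finsetSum _ fun i _ => Integrable.of_bound (htermm i ε).aestronglyMeasurable B
      (Filter.Eventually.of_forall (hterm i ε))
  set G : Matrix.orthogonalGroup (Fin d) ℝ × EuclideanSpace ℝ (Fin d) → ℝ := fun p =>
    inner ℝ (orthogonalIsometry p.1 w) (g.output (fun i => orthogonalIsometry p.1 (v i)) p.2) *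
      Real.sin (a * inner ℝ (orthogonalIsometry p.1 w) p.2) with hG
  have hGsum : ∀ p, G p = ∑ i, φ i p * (inner ℝ (orthogonalIsometry p.1 w)
      (T (orthogonalIsometry p.1 (v i))) * Real.sin (a * inner ℝ (orthogonalIsometry p.1 w) p.2)) :=
    fun p => by
      simp only [hG, AttentionHead.output, map_sum, map_smul, inner_sum, inner_smul_right,
        Finset.sum_mul, mul_assoc, hφ, hT]
  have hGm : Measurable G := by
    have h : G = fun p => ∑ i, φ i p * (inner ℝ (orthogonalIsometry p.1 w)
      (T (orthogonalIsometry p.1 (v i))) *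
        Real.sin (a * inner ℝ (orthogonalIsometry p.1 w) p.2)) := funext hGsum
    rw [h]
    refine Finset.measurable_sum _ fun i _ => (hφm i).mul (Measurable.mul ?_ ?_)
    · exact ((hOc w).inner (T.continuous.comp (hOc (v i)))).measurable
    · exact (Real.continuous_sin.comp (((hOc w).inner continuous_snd).const_mul a)).measurable
  have hGL : ∀ ε p, G (R ε * p.1, p.2) = L ε p := by
    intro ε p
    rw [hGsum]
    simp only [hL, hφ, hA, hθ, orthogonalIsometry_mul, hR, hKflip]
  -- Left invariance of Haar measure; y is left untouched.
  have hinv : ∀ ε, ∫ p, G p ∂μ = ∫ p, L ε p ∂μ := by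
    intro ε
    have hmp : MeasurePreserving (Prod.map (R ε * ·) id) μ μ :=
      (measurePreserving_mul_left (uniformOrthogonal d) (R ε)).prod (MeasurePreserving.id _)
    conv_lhs => rw [← hmp.map_eq]
    rw [integral_map hmp.measurable.aemeasurable hGm.aestronglyMeasurable]
    exact integral_congr_ae (Filter.Eventually.of_forall fun p => hGL ε p)
  set M : Fin N → Matrix.orthogonalGroup (Fin d) ℝ × EuclideanSpace ℝ (Fin d) → ℝ := fun i p =>
    (2 ^ d)⁻¹ * ∑ ε, A i ε p * Real.sin (θ ε p) with hM
  have hMc : ∀ i, Continuous (M i) := fun i =>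
    (continuous_finsetSum _ fun ε _ =>
      (hAc i ε).mul (Real.continuous_sin.comp (hθc ε))).const_mul _
  have hMB : ∀ i p, |M i p| ≤ B := by
    intro i p
    rw [abs_mul, abs_of_pos (by positivity), inv_mul_le_iff₀ (by positivity)]
    refine (Finset.abs_sum_le_sum_abs _ _).trans ?_
    have : ∀ ε ∈ Finset.univ, |A i ε p * Real.sin (θ ε p)| ≤ B := fun ε _ => by
      rw [abs_mul]
      calc _ ≤ B * 1 := by
            gcongr
            · exact hAB i ε p
            · exact Real.abs_sin_le_one _
        _ = B := mul_one _
    refine (Finset.sum_le_card_nsmul _ _ _ this).trans ?_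
    simp [Finset.card_univ]
  have hMLp : ∀ i, MemLp (M i) 2 μ := fun i =>
    MemLp.of_bound (hMc i).aestronglyMeasurable B (Filter.Eventually.of_forall (hMB i))
  -- The weights are blind to ε, so they factor out of the average over flips.
  have havg : ∫ p, G p ∂μ = ∫ p, ∑ i, φ i p * M i p ∂μ := by
    have h1 : ∫ p, G p ∂μ = (2 ^ d)⁻¹ * ∑ ε, ∫ p, L ε p ∂μ := by
      simp_rw [← hinv]
      simp [Finset.card_univ]
    rw [h1, ← integral_finsetSum _ fun ε _ => hLint ε, ← integral_const_mul]
    congr 1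
    ext p
    simp only [hL, hM]
    rw [Finset.sum_comm, Finset.mul_sum]
    refine Finset.sum_congr rfl fun i _ => ?_
    rw [← Finset.mul_sum]
    ring
  -- The amplitude `A` does not involve y, so it may be evaluated at y = 0 to serve as α.
  have hαB : ∀ i ε (U : Matrix.orthogonalGroup (Fin d) ℝ), |A i ε (U, 0)| ≤ B :=
    fun i ε U => hAB i ε _
  have hM2 : ∀ i, ∫ p, M i p ^ 2 ∂μ ≤ D ^ 2 := fun i =>
    integral_signFlip_average_sq_orthogonal_le hd b S w ha (hαB i) (hMLp i).integrable_sq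
  have hMabs : ∀ i, ∫ p, |M i p| ∂μ ≤ D := fun i =>
    integral_abs_le_of_integral_sq_le (hMLp i) hD0 (hM2 i)
  have hMint1 : ∀ i, Integrable (fun p => |M i p|) μ := fun i =>
    ((hMLp i).integrable (by norm_num)).abs
  calc |∫ p, G p ∂μ| = |∫ p, ∑ i, φ i p * M i p ∂μ| := by rw [havg]
    _ ≤ ∫ p, ∑ i, |M i p| ∂μ := by
        have hint : Integrable (fun p => ∑ i, |M i p|) μ :=
          integrable_finsetSum _ fun i _ => hMint1 i
        rw [← Real.norm_eq_abs]
        refine norm_integral_le_of_norm_le hint (Filter.Eventually.of_forall fun p => ?_)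
        refine (norm_sum_le _ _).trans (Finset.sum_le_sum fun i _ => ?_)
        rw [norm_mul]
        exact mul_le_of_le_one_left (abs_nonneg _) (hφ0 i p)
    _ = ∑ i, ∫ p, |M i p| ∂μ := integral_finsetSum _ fun i _ => hMint1 i
    _ ≤ ∑ _i : Fin N, D := Finset.sum_le_sum fun i _ => hMabs i
    _ = N * D := by simp
    _ ≤ _ := by
        have hdm : (d : ℝ) ≤ m + r := by exact_mod_cast hcard
        have hexp : Real.exp (-(decayRate * m)) ≤ Real.exp (-(decayRate * ((d : ℝ) - r))) :=
          Real.exp_le_exp.2 (neg_le_neg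
            (mul_le_mul_of_nonneg_left (by linarith) decayRate_pos.le))
        exact mul_le_mul_of_nonneg_left (mul_le_mul_of_nonneg_left hexp hB2)
          (Nat.cast_nonneg _)

end HeadCorrelation

/-! ### The unbiased nearest neighbour function on orthogonal pairs -/

section NearestNeighbor

variable {d : ℕ}

/-- The chosen point has inner product ±ρ² with u, with the sign of ⟨u, y⟩, and the sine is odd. At
a tie both sides vanish, so tie-breaking is harmless. -/
theorem IsBiasedNearestNeighbor.inner_sub_mul_sin
    {f : (Fin 2 → EuclideanSpace ℝ (Fin d)) → EuclideanSpace ℝ (Fin d) → EuclideanSpace ℝ (Fin d)}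
    (hf : IsBiasedNearestNeighbor 0 f) {X : Fin 2 → EuclideanSpace ℝ (Fin d)} {ρ : ℝ}
    (hX : ∀ i, ‖X i‖ = ρ) (hX' : inner ℝ (X 0) (X 1) = 0) (a : ℝ) (y : EuclideanSpace ℝ (Fin d)) :
    inner ℝ (X 0 - X 1) (f X y) * Real.sin (a * inner ℝ (X 0 - X 1) y) =
      ρ ^ 2 * Real.sin (a * |inner ℝ (X 0 - X 1) y|) := by
  obtain ⟨i, hfi, hi⟩ := hf X y
  have h0 := hi 0
  have h1 := hi 1
  simp only [Pi.zero_apply, add_zero, norm_sub_sq_real, hX] at h0 h1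
  rw [hfi]
  fin_cases i
  · have hy : 0 ≤ inner ℝ (X 0 - X 1) y := by
      rw [inner_sub_left]; simp only [Fin.zero_eta] at h1; linarith
    simp only [Fin.zero_eta]
    rw [abs_of_nonneg hy, inner_sub_left, real_inner_self_eq_norm_sq, real_inner_comm, hX', hX,
      sub_zero]
  · have hy : inner ℝ (X 0 - X 1) y ≤ 0 := by
      rw [inner_sub_left]; simp only [Fin.mk_one] at h0; linarith
    simp only [Fin.mk_one]
    rw [abs_of_nonpos hy, mul_neg, Real.sin_neg, inner_sub_left (X 0) (X 1) (X 1),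
      real_inner_self_eq_norm_sq, hX', hX]
    ring

theorem norm_scaledColumns {N : ℕ} (hN : N ≤ d) {ρ : ℝ} (hρ : 0 ≤ ρ)
    (U : Matrix.orthogonalGroup (Fin d) ℝ) (i : Fin N) : ‖scaledColumns hN ρ U i‖ = ρ := by
  rw [scaledColumns_eq, LinearIsometryEquiv.norm_map, norm_smul, Real.norm_of_nonneg hρ]
  simp

theorem inner_scaledColumns {N : ℕ} (hN : N ≤ d) (ρ : ℝ)
    (U : Matrix.orthogonalGroup (Fin d) ℝ) {i j : Fin N} (hij : i ≠ j) :
    inner ℝ (scaledColumns hN ρ U i) (scaledColumns hN ρ U j) = 0 := by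
  rw [scaledColumns_eq, scaledColumns_eq, LinearIsometryEquiv.inner_map_map, real_inner_smul_left,
    real_inner_smul_right, EuclideanSpace.inner_single_left]
  have : Fin.castLE hN i ≠ Fin.castLE hN j := fun h => hij (Fin.castLE_injective hN h)
  simp [this]

theorem uniformOrthogonalFrame_prod {N : ℕ} (hN : N ≤ d) (ρ : ℝ) :
    (uniformOrthogonalFrame hN ρ).prod (stdGaussian (EuclideanSpace ℝ (Fin d))) =
      ((uniformOrthogonal d).prod (stdGaussian (EuclideanSpace ℝ (Fin d)))).map
        (Prod.map (scaledColumns hN ρ) id) := by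
  rw [← Measure.map_prod_map _ _ (measurable_scaledColumns hN ρ) measurable_id, Measure.map_id]
  rfl

/-- With arbitrary tie-breaking f need not be measurable, and the Bochner integral of the error
could default to 0. Off the null set of ties f agrees with a measurable choice. -/
theorem IsBiasedNearestNeighbor.aestronglyMeasurable
    {f : (Fin 2 → EuclideanSpace ℝ (Fin d)) → EuclideanSpace ℝ (Fin d) → EuclideanSpace ℝ (Fin d)}
    (hf : IsBiasedNearestNeighbor 0 f) (hd : 2 ≤ d) {ρ : ℝ} (hρ : 0 < ρ) :
    AEStronglyMeasurable (fun p => f p.1 p.2)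
      ((uniformOrthogonalFrame hd ρ).prod (stdGaussian (EuclideanSpace ℝ (Fin d)))) := by
  set f₀ : (Fin 2 → EuclideanSpace ℝ (Fin d)) × EuclideanSpace ℝ (Fin d) →
      EuclideanSpace ℝ (Fin d) := fun p =>
      if ‖p.1 0 - p.2‖ ^ 2 ≤ ‖p.1 1 - p.2‖ ^ 2 then p.1 0 else p.1 1
    with hf₀
  have hf₀m : Measurable f₀ :=
    Measurable.ite (measurableSet_le (by fun_prop) (by fun_prop)) (by fun_prop) (by fun_prop)
  refine ⟨f₀, hf₀m.stronglyMeasurable, ?_⟩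
  set tie : Set ((Fin 2 → EuclideanSpace ℝ (Fin d)) × EuclideanSpace ℝ (Fin d)) :=
    {p | ‖p.1 0 - p.2‖ ^ 2 = ‖p.1 1 - p.2‖ ^ 2} with htie
  have htiem : MeasurableSet tie := measurableSet_eq_fun (by fun_prop) (by fun_prop)
  have hsm : Measurable (Prod.map (scaledColumns hd ρ) (id : EuclideanSpace ℝ (Fin d) → _)) :=
    (measurable_scaledColumns hd ρ).prodMap measurable_id
  have hnull : ((uniformOrthogonalFrame hd ρ).prod
      (stdGaussian (EuclideanSpace ℝ (Fin d)))) tie = 0 := by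
    rw [uniformOrthogonalFrame_prod, Measure.map_apply hsm htiem,
      Measure.measure_prod_null (hsm htiem)]
    refine Filter.Eventually.of_forall fun U => ?_
    have hn := norm_scaledColumns hd hρ.le U
    have hne : scaledColumns hd ρ U 0 - scaledColumns hd ρ U 1 ≠ 0 := by
      intro h
      have h1 := inner_scaledColumns hd ρ U (show (0 : Fin 2) ≠ 1 by decide)
      rw [← sub_eq_zero.1 h, real_inner_self_eq_norm_sq, hn] at h1
      exact hρ.ne' (pow_eq_zero_iff two_ne_zero |>.1 h1)
    refine measure_mono_null (fun y hy => ?_) (stdGaussian_inner_eq_zero hne)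
    have hy' : ‖scaledColumns hd ρ U 0 - y‖ ^ 2 = ‖scaledColumns hd ρ U 1 - y‖ ^ 2 := hy
    rw [norm_sub_sq_real, norm_sub_sq_real, hn, hn] at hy'
    change inner ℝ _ y = 0
    rw [inner_sub_left]
    linarith
  filter_upwards [compl_mem_ae_iff.2 hnull] with p hp
  have hp' : ‖p.1 0 - p.2‖ ^ 2 ≠ ‖p.1 1 - p.2‖ ^ 2 := hp
  obtain ⟨i, hfi, hi⟩ := hf p.1 p.2
  have h0 := hi 0
  have h1 := hi 1
  simp only [Pi.zero_apply, add_zero] at h0 h1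
  rw [hfi]
  simp only [hf₀]
  fin_cases i
  · simp only [Fin.zero_eta] at h1 ⊢
    rw [if_pos h1]
  · simp only [Fin.mk_one] at h0 ⊢
    rw [if_neg fun h => hp' (le_antisymm h h0)]

theorem IsBiasedNearestNeighbor.norm_le {N : ℕ} {b : Fin N → ℝ}
    {f : (Fin N → EuclideanSpace ℝ (Fin d)) → EuclideanSpace ℝ (Fin d) → EuclideanSpace ℝ (Fin d)}
    (hf : IsBiasedNearestNeighbor b f) {X : Fin N → EuclideanSpace ℝ (Fin d)} {ρ : ℝ}
    (hX : ∀ i, ‖X i‖ ≤ ρ) (y : EuclideanSpace ℝ (Fin d)) : ‖f X y‖ ≤ ρ := by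
  obtain ⟨i, hfi, -⟩ := hf X y
  rw [hfi]
  exact hX i

end NearestNeighbor

/-! ### Norm bound and measurability of head outputs -/

namespace AttentionHead

variable {d N r : ℕ}

theorem norm_output_le (g : AttentionHead d N r) {X : Fin N → EuclideanSpace ℝ (Fin d)} {ρ : ℝ}
    (hX : ∀ i, ‖X i‖ ≤ ρ) (y : EuclideanSpace ℝ (Fin d)) : ‖g.output X y‖ ≤ g.weightNorm * ρ := by
  refine (ContinuousLinearMap.le_opNorm _ _).trans
    (mul_le_mul_of_nonneg_left ?_ (norm_nonneg _))
  obtain ⟨h0, h1⟩ := g.φ_mem (fun j => g.K *ᵥ (X j).ofLp) y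
  calc _ ≤ ∑ i, g.φ (fun j => g.K *ᵥ (X j).ofLp) y i * ρ := by
        refine (norm_sum_le _ _).trans (Finset.sum_le_sum fun i _ => ?_)
        rw [norm_smul, Real.norm_of_nonneg (h0 i)]
        exact mul_le_mul_of_nonneg_left (hX i) (h0 i)
    _ = ρ := by rw [← Finset.sum_mul, h1, one_mul]

theorem measurable_output_comp {Ω : Type*} [MeasurableSpace Ω] (g : AttentionHead d N r)
    {X : Ω → Fin N → EuclideanSpace ℝ (Fin d)} {y : Ω → EuclideanSpace ℝ (Fin d)}
    (hX : Measurable X) (hy : Measurable y) : Measurable fun ω => g.output (X ω) (y ω) := by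
  have h : Measurable fun ω => ((fun j => g.K *ᵥ (X ω j).ofLp, y ω) :
      (Fin N → Fin g.k → ℝ) × EuclideanSpace ℝ (Fin d)) := by
    refine Measurable.prodMk (measurable_pi_lambda _ fun j => ?_) hy
    have hc : Continuous fun x : EuclideanSpace ℝ (Fin d) => g.K *ᵥ x.ofLp :=
      Continuous.matrix_mulVec continuous_const (PiLp.continuous_ofLp 2 _)
    exact hc.measurable.comp ((measurable_pi_apply j).comp hX)
  refine (ContinuousLinearMap.measurable _).comp (Finset.measurable_sum _ fun i _ => ?_)
  exact ((measurable_pi_apply i).comp (g.measurable_φ.comp h)).smul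
    ((measurable_pi_apply i).comp hX)

end AttentionHead

/-! ### Lower bound for the error through the test field -/

theorem le_integral_sin_abs_inner_stdGaussian {d : ℕ} (hd : 0 < d)
    {u : EuclideanSpace ℝ (Fin d)} {a : ℝ} (ha : 0 ≤ a) (hu : (a * ‖u‖) ^ 2 = 8 * (d : ℝ) ^ 2) :
    (7 / 25) / d - 1 / (4 * (d : ℝ) ^ 2) ≤
      ∫ y, Real.sin (a * |inner ℝ u y|) ∂(stdGaussian (EuclideanSpace ℝ (Fin d))) := by
  have hd' : (0 : ℝ) < d := by exact_mod_cast hd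
  set w := a * ‖u‖ with hw
  have hw0 : 0 < w := by
    refine lt_of_le_of_ne (by positivity) fun h => ?_
    rw [← h] at hu
    have : 0 < 8 * (d : ℝ) ^ 2 := by positivity
    norm_num at hu
    omega
  rw [integral_comp_inner_stdGaussian (f := fun t => Real.sin (a * |t|)) u (by fun_prop)]
  simp_rw [abs_mul, abs_norm, ← mul_assoc]
  refine le_trans ?_ (le_integral_sin_abs_gaussianReal hw0)
  have h1 : 2 / w ^ 2 = 1 / (4 * (d : ℝ) ^ 2) := by
    rw [hu]; field_simp; norm_num
  -- Squared, this is 16π ≤ (50/7)²; it produces the constant 7/25 = 2/(50/7).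
  have h2 : √(2 * Real.pi) * w ≤ 50 / 7 * d := by
    refine (le_abs_self _).trans (abs_le_of_sq_le_sq ?_ (by positivity))
    rw [mul_pow, Real.sq_sqrt (by positivity), hu]
    nlinarith [Real.pi_lt_d2, sq_nonneg (d : ℝ)]
  have h3 : (7 / 25) / (d : ℝ) ≤ 2 * (√(2 * Real.pi))⁻¹ / w := by
    have hs : 0 < √(2 * Real.pi) := Real.sqrt_pos.2 (by positivity)
    rw [← div_eq_mul_inv, div_div _ _ w, div_le_div_iff₀ hd' (mul_pos hs hw0)]
    linarith
  rw [h1]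
  linarith

/-- By the double-angle formula: the Gaussian mean of the cosine is positive. -/
theorem integral_sin_sq_inner_stdGaussian_le {d : ℕ} (u : EuclideanSpace ℝ (Fin d)) (a : ℝ) :
    ∫ y, Real.sin (a * inner ℝ u y) ^ 2 ∂(stdGaussian (EuclideanSpace ℝ (Fin d))) ≤ 1 / 2 := by
  have h : ∀ y : EuclideanSpace ℝ (Fin d), Real.sin (a * inner ℝ u y) ^ 2 =
      1 / 2 - Real.cos (inner ℝ ((2 * a) • u) y) / 2 := by
    intro y
    rw [Real.sin_sq_eq_half_sub, real_inner_smul_left]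
    ring_nf
  simp_rw [h]
  rw [integral_sub (integrable_const _), integral_div (2 : ℝ) (fun y => Real.cos _),
    integral_cos_inner_stdGaussian]
  · have := Real.exp_pos (-‖(2 * a) • u‖ ^ 2 / 2)
    simp
    positivity
  · exact (Integrable.of_bound (by fun_prop) 1
      (Filter.Eventually.of_forall fun y => Real.abs_cos_le_one _)).div_const _

theorem integral_mul_sub_sum_sub_mul {Ω κ : Type*} [MeasurableSpace Ω] [Fintype κ] {μ : Measure Ω}
    {P S : Ω → ℝ} {Q : κ → Ω → ℝ} (hP : Integrable P μ) (hS : Integrable S μ)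
    (hQ : ∀ k, Integrable (Q k) μ) (x y z : ℝ) :
    Integrable (fun ω => x * (y * P ω - ∑ k, Q k ω) - z * S ω) μ ∧
      ∫ ω, x * (y * P ω - ∑ k, Q k ω) - z * S ω ∂μ =
        x * (y * ∫ ω, P ω ∂μ - ∑ k, ∫ ω, Q k ω ∂μ) - z * ∫ ω, S ω ∂μ := by
  have hQs : Integrable (fun ω => ∑ k, Q k ω) μ := integrable_finsetSum _ fun k _ => hQ k
  have hPQ : Integrable (fun ω => y * P ω - ∑ k, Q k ω) μ := (hP.const_mul y).sub hQs
  refine ⟨(hPQ.const_mul x).sub (hS.const_mul z), ?_⟩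
  rw [integral_sub (hPQ.const_mul x) (hS.const_mul z), integral_const_mul,
    integral_sub (hP.const_mul y) hQs, integral_const_mul, integral_const_mul,
    integral_finsetSum _ fun k _ => hQ k]

section TestFunction

variable {d r H : ℕ}

/-- For the error F and the test field T = sin(a⟨u, y⟩) u, this integrates ‖F‖² ≥ 2τ⟨F, T⟩ - τ²‖T‖².
Since ‖u‖² = 2ρ² and sin² has mean at most 1/2, the quadratic loss is at most τ²ρ². -/
theorem le_integral_norm_sub_sum_output_sq (hd : 2 ≤ d) {ρ a τ : ℝ} (hρ : 0 < ρ)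
    {f : (Fin 2 → EuclideanSpace ℝ (Fin d)) → EuclideanSpace ℝ (Fin d) → EuclideanSpace ℝ (Fin d)}
    (hf : IsBiasedNearestNeighbor 0 f) (g : Fin H → AttentionHead d 2 r)
    (w : EuclideanSpace ℝ (Fin d))
    (hw : ∀ U, orthogonalIsometry U w = scaledColumns hd ρ U 0 - scaledColumns hd ρ U 1) {s : ℝ}
    (hs : ∀ U, s ≤ ∫ y, Real.sin (a * |inner ℝ (orthogonalIsometry U w) y|)
      ∂(stdGaussian (EuclideanSpace ℝ (Fin d)))) (hτ : 0 ≤ τ) :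
    2 * τ * (ρ ^ 2 * s - ∑ h, ∫ p, inner ℝ (orthogonalIsometry p.1 w)
          ((g h).output (scaledColumns hd ρ p.1) p.2) *
        Real.sin (a * inner ℝ (orthogonalIsometry p.1 w) p.2)
        ∂((uniformOrthogonal d).prod (stdGaussian (EuclideanSpace ℝ (Fin d))))) -
      τ ^ 2 * ρ ^ 2 ≤
      ∫ p, ‖f p.1 p.2 - ∑ h, (g h).output p.1 p.2‖ ^ 2
        ∂((uniformOrthogonalFrame hd ρ).prod (stdGaussian (EuclideanSpace ℝ (Fin d)))) := by
  set μ := (uniformOrthogonal d).prod (stdGaussian (EuclideanSpace ℝ (Fin d))) with hμ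
  have hX := norm_scaledColumns (d := d) hd hρ.le
  have hX01 : ∀ U, inner ℝ (scaledColumns hd ρ U 0) (scaledColumns hd ρ U 1) = 0 := fun U =>
    inner_scaledColumns hd ρ U (show (0 : Fin 2) ≠ 1 by decide)
  have hu : ∀ U, ‖orthogonalIsometry U w‖ ^ 2 = 2 * ρ ^ 2 := by
    intro U
    rw [hw, norm_sub_sq_real, hX01, hX, hX]
    ring
  have hsm : Measurable (Prod.map (scaledColumns hd ρ) (id : EuclideanSpace ℝ (Fin d) → _)) :=
    (measurable_scaledColumns hd ρ).prodMap measurable_id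
  have houtm : ∀ h, Measurable fun p : Matrix.orthogonalGroup (Fin d) ℝ ×
      EuclideanSpace ℝ (Fin d) => (g h).output (scaledColumns hd ρ p.1) p.2 := fun h =>
    (g h).measurable_output_comp ((measurable_scaledColumns hd ρ).comp measurable_fst)
      measurable_snd
  have hFm : AEStronglyMeasurable (fun p => f p.1 p.2 - ∑ h, (g h).output p.1 p.2)
      ((uniformOrthogonalFrame hd ρ).prod (stdGaussian (EuclideanSpace ℝ (Fin d)))) :=
    (hf.aestronglyMeasurable hd hρ).sub
      (Finset.measurable_sum _ fun h _ =>
        (g h).measurable_output_comp measurable_fst measurable_snd).aestronglyMeasurable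
  rw [uniformOrthogonalFrame_prod] at hFm ⊢
  have hFm2 : AEStronglyMeasurable
      (fun p : (Fin 2 → EuclideanSpace ℝ (Fin d)) × EuclideanSpace ℝ (Fin d) =>
        ‖f p.1 p.2 - ∑ h, (g h).output p.1 p.2‖ ^ 2)
      (μ.map (Prod.map (scaledColumns hd ρ) id)) := hFm.norm.pow 2
  have hFm3 := hFm2.comp_measurable hsm
  rw [integral_map hsm.aemeasurable hFm2]
  obtain ⟨out, hout⟩ : ∃ out : Fin H → Matrix.orthogonalGroup (Fin d) ℝ ×
      EuclideanSpace ℝ (Fin d) → EuclideanSpace ℝ (Fin d),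
      ∀ h p, (g h).output (scaledColumns hd ρ p.1) p.2 = out h p := ⟨_, fun _ _ => rfl⟩
  have houtn : ∀ h p, ‖out h p‖ ≤ (g h).weightNorm * ρ := fun h p => by
    rw [← hout]
    exact (g h).norm_output_le (fun i => (hX _ i).le) _
  simp only [Function.comp_def, Prod.map_fst, Prod.map_snd, id, hout] at houtm hFm3 ⊢
  have huc : Continuous fun p : Matrix.orthogonalGroup (Fin d) ℝ × EuclideanSpace ℝ (Fin d) =>
      orthogonalIsometry p.1 w := continuous_orthogonalIsometry_fst w
  have huy : Continuous fun p : Matrix.orthogonalGroup (Fin d) ℝ × EuclideanSpace ℝ (Fin d) =>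
      inner ℝ (orthogonalIsometry p.1 w) p.2 := huc.inner continuous_snd
  have hFint : Integrable (fun p : Matrix.orthogonalGroup (Fin d) ℝ × EuclideanSpace ℝ (Fin d) =>
      ‖f (scaledColumns hd ρ p.1) p.2 - ∑ h, out h p‖ ^ 2) μ := by
    refine Integrable.of_bound hFm3
      ((ρ + ∑ h, (g h).weightNorm * ρ) ^ 2) (Filter.Eventually.of_forall fun p => ?_)
    rw [Real.norm_of_nonneg (sq_nonneg _)]
    refine pow_le_pow_left₀ (norm_nonneg _) ?_ 2
    refine (norm_sub_le _ _).trans (add_le_add (hf.norm_le (fun i => (hX _ i).le) _) ?_)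
    exact (norm_sum_le _ _).trans
      (Finset.sum_le_sum fun h _ => houtn h p)
  have hPint : Integrable (fun p : Matrix.orthogonalGroup (Fin d) ℝ × EuclideanSpace ℝ (Fin d) =>
      Real.sin (a * |inner ℝ (orthogonalIsometry p.1 w) p.2|)) μ :=
    Integrable.of_bound (Real.continuous_sin.comp (huy.abs.const_mul a)).aestronglyMeasurable 1
      (Filter.Eventually.of_forall fun p => Real.abs_sin_le_one _)
  have hsinc : Continuous fun p : Matrix.orthogonalGroup (Fin d) ℝ × EuclideanSpace ℝ (Fin d) =>
      Real.sin (a * inner ℝ (orthogonalIsometry p.1 w) p.2) :=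
    Real.continuous_sin.comp (huy.const_mul a)
  have hSint : Integrable (fun p : Matrix.orthogonalGroup (Fin d) ℝ × EuclideanSpace ℝ (Fin d) =>
      Real.sin (a * inner ℝ (orthogonalIsometry p.1 w) p.2) ^ 2) μ :=
    Integrable.of_bound (hsinc.pow 2).aestronglyMeasurable 1
      (Filter.Eventually.of_forall fun p => by
        rw [Real.norm_of_nonneg (sq_nonneg _)]
        exact Real.sin_sq_le_one _)
  have hQint : ∀ h, Integrable (fun p : Matrix.orthogonalGroup (Fin d) ℝ ×
      EuclideanSpace ℝ (Fin d) => inner ℝ (orthogonalIsometry p.1 w)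
          (out h p) *
        Real.sin (a * inner ℝ (orthogonalIsometry p.1 w) p.2)) μ := by
    intro h
    refine Integrable.of_bound ((huc.measurable.inner (houtm h)).mul
      hsinc.measurable).aestronglyMeasurable (‖w‖ * ((g h).weightNorm * ρ) * 1)
      (Filter.Eventually.of_forall fun p => ?_)
    rw [norm_mul]
    refine mul_le_mul ?_ (Real.abs_sin_le_one _) (norm_nonneg _) ?_
    · refine (abs_real_inner_le_norm _ _).trans ?_
      rw [LinearIsometryEquiv.norm_map]
      exact mul_le_mul_of_nonneg_left (houtn h p)
        (norm_nonneg _)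
    · exact mul_nonneg (norm_nonneg _) (mul_nonneg (norm_nonneg _) hρ.le)
  have hpt : ∀ p : Matrix.orthogonalGroup (Fin d) ℝ × EuclideanSpace ℝ (Fin d),
      2 * τ * (ρ ^ 2 * Real.sin (a * |inner ℝ (orthogonalIsometry p.1 w) p.2|) -
        ∑ h, inner ℝ (orthogonalIsometry p.1 w) (out h p) *
          Real.sin (a * inner ℝ (orthogonalIsometry p.1 w) p.2)) -
      τ ^ 2 * (2 * ρ ^ 2) * Real.sin (a * inner ℝ (orthogonalIsometry p.1 w) p.2) ^ 2 ≤
      ‖f (scaledColumns hd ρ p.1) p.2 - ∑ h, out h p‖ ^ 2 := by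
    intro p
    have hfp := hf.inner_sub_mul_sin (hX p.1) (hX01 p.1) a p.2
    rw [← hw] at hfp
    rw [← hfp, ← hu p.1, ← Finset.sum_mul, ← inner_sum, ← sub_mul, ← inner_sub_right]
    set F := f (scaledColumns hd ρ p.1) p.2 - ∑ h, out h p
    set u := orthogonalIsometry p.1 w
    set t := Real.sin (a * inner ℝ u p.2)
    have h := sq_nonneg ‖F - (τ * t) • u‖
    rw [norm_sub_sq_real, real_inner_smul_right, norm_smul, mul_pow, Real.norm_eq_abs, sq_abs,
      real_inner_comm] at h
    linarith
  have hlin := integral_mul_sub_sum_sub_mul (Q := fun h p => inner ℝ (orthogonalIsometry p.1 w)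
      (out h p) *
        Real.sin (a * inner ℝ (orthogonalIsometry p.1 w) p.2)) hPint hSint hQint (2 * τ) (ρ ^ 2)
    (τ ^ 2 * (2 * ρ ^ 2))
  have hmain := integral_mono hlin.1 hFint hpt
  rw [hlin.2] at hmain
  refine le_trans ?_ hmain
  have hP : s ≤ ∫ p, Real.sin (a * |inner ℝ (orthogonalIsometry p.1 w) p.2|) ∂μ := by
    rw [integral_prod _ hPint]
    calc s = ∫ _U, s ∂(uniformOrthogonal d) := by simp
      _ ≤ _ := integral_mono (integrable_const _) hPint.integral_prod_left hs
  have hS : ∫ p, Real.sin (a * inner ℝ (orthogonalIsometry p.1 w) p.2) ^ 2 ∂μ ≤ 1 / 2 := by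
    rw [integral_prod _ hSint]
    calc _ ≤ ∫ _U, (1 / 2 : ℝ) ∂(uniformOrthogonal d) :=
          integral_mono hSint.integral_prod_left (integrable_const _) fun U =>
            integral_sin_sq_inner_stdGaussian_le (orthogonalIsometry U w) a
      _ = 1 / 2 := by simp
  have h1 := mul_le_mul_of_nonneg_left hP (sq_nonneg ρ)
  have h2 := mul_le_mul_of_nonneg_left hS (by positivity : 0 ≤ τ ^ 2 * (2 * ρ ^ 2))
  have h3 : ∀ q : ℝ, 2 * τ * (ρ ^ 2 * s - q) ≤ 2 * τ * (ρ ^ 2 *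
      ∫ p, Real.sin (a * |inner ℝ (orthogonalIsometry p.1 w) p.2|) ∂μ - q) := fun q =>
    mul_le_mul_of_nonneg_left (by linarith) (by positivity)
  refine (sub_le_sub (h3 _) h2).trans' (le_of_eq ?_)
  ring

end TestFunction

/-! ### Choice of constants -/

theorem theorem4 :
    ∃ c₁ c₂ : ℝ, 0 < c₁ ∧ 0 < c₂ ∧
      ∀ (d : ℕ) (hd : 2 ≤ d),
        ∃ b : Fin 2 → ℝ,
          ∀ f : (Fin 2 → EuclideanSpace ℝ (Fin d)) → EuclideanSpace ℝ (Fin d) →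
              EuclideanSpace ℝ (Fin d),
            IsBiasedNearestNeighbor b f →
            ∀ (r H : ℕ) (g : Fin H → AttentionHead d 2 r),
              (H : ℝ) * (⨆ h, (g h).weightNorm) ≤
                  Real.exp (c₁ * ((d : ℝ) - (r : ℝ))) / ((d : ℝ) ^ 2 * c₂) →
              (1 / 20 : ℝ) <
                ∫ p, ‖f p.1 p.2 - ∑ h, (g h).output p.1 p.2‖ ^ 2
                  ∂((uniformOrthogonalFrame hd ((d : ℝ) ^ 2)).prod
                    (stdGaussian (EuclideanSpace ℝ (Fin d)))) := by
  refine ⟨decayRate, 100, decayRate_pos, by norm_num, fun d hd => ⟨0, fun f hf r H g hH => ?_⟩⟩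
  have hd0 : 0 < d := by omega
  have hd2 : (2 : ℝ) ≤ d := by exact_mod_cast hd
  have hd' : (0 : ℝ) < d := by linarith
  set ρ : ℝ := (d : ℝ) ^ 2 with hρ
  have hρ0 : 0 < ρ := by positivity
  set v : Fin 2 → EuclideanSpace ℝ (Fin d) := fun i =>
    ρ • EuclideanSpace.single (Fin.castLE hd i) (1 : ℝ) with hv
  have hvX : ∀ U, scaledColumns hd ρ U = fun i => orthogonalIsometry U (v i) := fun U =>
    funext fun i => scaledColumns_eq hd ρ U i
  set w := v 0 - v 1 with hw
  have hwX : ∀ U, orthogonalIsometry U w = scaledColumns hd ρ U 0 - scaledColumns hd ρ U 1 := by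
    intro U
    rw [hvX, hw, map_sub]
  have hvn : ∀ i, ‖v i‖ = ρ := by
    intro i
    rw [← LinearIsometryEquiv.norm_map (orthogonalIsometry 1), ← norm_scaledColumns hd hρ0.le 1 i,
      hvX]
  have hwn : ‖w‖ ^ 2 = 2 * ρ ^ 2 := by
    rw [← LinearIsometryEquiv.norm_map (orthogonalIsometry 1), hwX, norm_sub_sq_real,
      inner_scaledColumns hd ρ 1 (show (0 : Fin 2) ≠ 1 by decide), norm_scaledColumns hd hρ0.le,
      norm_scaledColumns hd hρ0.le]
    ring
  have hwn' : ‖w‖ = √2 * ρ := by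
    rw [← Real.sqrt_sq (norm_nonneg w), hwn, Real.sqrt_mul two_pos.le, Real.sqrt_sq hρ0.le]
  -- The frequency a‖w‖ = 2√2 d is large enough for the decay of head correlations (which needs
  -- order √d), yet costs the target only a factor of order 1/d.
  set a : ℝ := 2 / d with ha
  have ha0 : 0 ≤ a := by positivity
  have haw : a ^ 2 * ‖w‖ ^ 2 = 8 * (d : ℝ) ^ 2 := by
    rw [hwn, ha, hρ]
    field_simp
    norm_num
  have haw' : 3 * (d : ℝ) ≤ 2 * a ^ 2 * ‖w‖ ^ 2 := by
    rw [mul_assoc, haw]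
    nlinarith
  -- This τ makes the quadratic loss 1/16 and the loss from the heads at most 1/50.
  have hmain := le_integral_norm_sub_sum_output_sq (τ := 1 / (4 * ρ)) hd hρ0 hf g w hwX
    (fun U => le_integral_sin_abs_inner_stdGaussian hd0 ha0
      (by rw [LinearIsometryEquiv.norm_map, mul_pow, haw])) (by positivity)
  refine lt_of_lt_of_le ?_ hmain
  have hsum : ∑ h, ∫ p, inner ℝ (orthogonalIsometry p.1 w)
          ((g h).output (scaledColumns hd ρ p.1) p.2) *
        Real.sin (a * inner ℝ (orthogonalIsometry p.1 w) p.2)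
        ∂((uniformOrthogonal d).prod (stdGaussian (EuclideanSpace ℝ (Fin d)))) ≤ ρ / 25 := by
    set e := Real.exp (-(decayRate * ((d : ℝ) - r))) with he
    have he0 : 0 < e := Real.exp_pos _
    have hterm : ∀ h, ∫ p, inner ℝ (orthogonalIsometry p.1 w)
          ((g h).output (scaledColumns hd ρ p.1) p.2) *
        Real.sin (a * inner ℝ (orthogonalIsometry p.1 w) p.2)
        ∂((uniformOrthogonal d).prod (stdGaussian (EuclideanSpace ℝ (Fin d)))) ≤
        4 * ρ ^ 2 * e * ⨆ h, (g h).weightNorm := by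
      intro h
      have hb := (le_abs_self _).trans
        (abs_integral_inner_output_mul_sin_le hd0 (g h) v w hρ0.le (fun i => (hvn i).le) haw')
      simp_rw [← hvX] at hb
      refine hb.trans ?_
      have h2 : √2 * √2 = 2 := Real.mul_self_sqrt two_pos.le
      -- The factor 2 counts the points; one √2 is from ‖w‖ = √2 ρ, the other from the Haar
      -- comparison.
      calc _ = 2 * (√2 * √2) * ρ ^ 2 * e * (g h).weightNorm := by
            rw [hwn']; push_cast; ring
        _ ≤ 2 * (√2 * √2) * ρ ^ 2 * e * ⨆ h, (g h).weightNorm := by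
            refine mul_le_mul_of_nonneg_left (le_ciSup (f := fun h => (g h).weightNorm)
              (Set.finite_range _).bddAbove h)
              (by positivity)
        _ = _ := by rw [h2]; ring
    refine (Finset.sum_le_sum fun h _ => hterm h).trans ?_
    rw [Finset.sum_const, Finset.card_univ, Fintype.card_fin, nsmul_eq_mul]
    have hee : e * Real.exp (decayRate * ((d : ℝ) - r)) = 1 := by
      rw [he, ← Real.exp_add, neg_add_cancel, Real.exp_zero]
    calc (H : ℝ) * (4 * ρ ^ 2 * e * ⨆ h, (g h).weightNorm)
        = 4 * ρ ^ 2 * e * (H * ⨆ h, (g h).weightNorm) := by ring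
      _ ≤ 4 * ρ ^ 2 * e * (Real.exp (decayRate * ((d : ℝ) - r)) / (ρ * 100)) :=
          mul_le_mul_of_nonneg_left hH (by positivity)
      _ = 4 * ρ ^ 2 * (e * Real.exp (decayRate * ((d : ℝ) - r))) / (ρ * 100) := by ring
      _ = ρ / 25 := by
          rw [hee]
          field_simp
          norm_num
  -- Increasing in d, with value 0.0725 > 1/20 at d = 2.
  have h1 : 2 * (1 / (4 * ρ)) * (ρ ^ 2 * ((7 / 25) / d - 1 / (4 * (d : ℝ) ^ 2)) - ρ / 25) -
      (1 / (4 * ρ)) ^ 2 * ρ ^ 2 = 7 / 50 * d - 1 / 8 - 1 / 50 - 1 / 16 := by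
    rw [hρ]
    field_simp
    ring
  have h2 := mul_le_mul_of_nonneg_left (sub_le_sub_left hsum
    (ρ ^ 2 * ((7 / 25) / d - 1 / (4 * (d : ℝ) ^ 2)))) (by positivity : 0 ≤ 2 * (1 / (4 * ρ)))
  linarith

end
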